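/- **Setting.** For integers $W,L\ge 1$ let $N=W^2L^2$. For a family of parameters with $N\to\infty$ and $W\ge N^{\mathfrak c}$ for a fixed $\mathfrak c>0$, let $|\cdot|_L$ be the periodic $L^1$ distance on $\mathbb Z_L^2$, and for $x\in\mathbb Z_{WL}^2$ let $[x]\in\mathbb Z_L^2$ be the index of the $W\times W$ block that contains $x$. Put $S^{(B)}_{ab}=\frac15\mathbf 1(|a-b|_L\le 1)$ for $a,b\in\mathbb Z_L^2$, and $S_{xy}=W^{-2}S^{(B)}_{[x][y]}$ for $x,y\in\mathbb Z_{WL}^2$. Let $H=(H_{xy})_{x,y\in\mathbb Z_{WL}^2}$ be Hermitian, with entries that are independent up to this symmetry, $H_{xy}\sim\mathcal{CN}(0,S_{xy})$ for $x\neq y$ and $H_{xx}\sim\mathcal N_{\mathbb R}(0,S_{xx})$. Fix $\kappa,\delta>0$ and let $|E|\le 2-\kappa$. Let $m=\frac12(-E+i\sqrt{4-E^2})$ and, for $0\le t<1$, $$z_t=E+(1-t)m,\quad \eta_t=\operatorname{Im} z_t,\quad \ell_t=\min\big((1-t)^{-1/2},L\big),\quad M_t=W^2\ell_t^2\eta_t,$$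 $$G_t(+)=(\sqrt t\,H-z_t)^{-1},\qquad G_t(-)=(\sqrt t\,H-\bar z_t)^{-1}=G_t(+)^\dagger.$$ Let $(E_a)_{xy}=\delta_{xy}W^{-2}\mathbf 1([x]=a)$, $\ \mathcal L_{t,(a,b)}=\operatorname{tr}\big(G_t(+)E_aG_t(-)E_b\big)$ and $\mathcal K_{t,(a,b)}=W^{-2}|m|^2\big[(1-t|m|^2S^{(B)})^{-1}\big]_{ab}$. For non-negative families $\xi(v),\zeta(v)$ of random variables, $\xi\prec\zeta$ (uniformly in $v$) means: for all fixed $\varepsilon,D>0$, $\ \mathbb P\big(\bigcup_v\{\xi(v)>N^{\varepsilon}\zeta(v)\}\big)\le N^{-D}$ for all sufficiently large $N$; for deterministic families it means: for all fixed $\varepsilon>0$, $\ \xi(v)\le N^\varepsilon\zeta(v)$ for all $v$, for all sufficiently large $N$. For complex quantities $\xi\prec\zeta$ means $|\xi|\prec\zeta$. The parameters $W,L,E,r,s,t,\sigma_i,C_{b,\mathbf x,\mathbf y},\Lambda,Z$ may depend on $N$. **Assumptions.** Let $0\le r\le s\le 1-N^{-1+\delta}$, and assume the local law and the two-loop decay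 at time $s$: $$\max_{x,y}\big|(G_s(+)-m)_{xy}\big|\prec M_s^{-1/2},$$ $$\big|\mathcal L_{s,(a,b)}-\mathcal K_{s,(a,b)}\big|\prec\Big(\frac{\eta_r}{\eta_s}\Big)^4M_s^{-2}\exp\Big(-\frac{|a-b|_L^{1/2}}{\ell_s^{1/2}}\Big)+W^{-D}\quad\text{for every }D>0,$$ uniformly in $a,b\in\mathbb Z_L^2$. Fix $u\in\mathbb N$, signs $\sigma_1,\dots,\sigma_u\in\{+,-\}$, and let $$Y_{s,b}=\sum_{\mathbf x,\mathbf y\in(\mathbb Z_{WL}^2)^u}C_{b,\mathbf x,\mathbf y}\prod_{i=1}^uG_s(\sigma_i)_{x_iy_i},\qquad b\in\mathbb Z_L^2,$$ where the coefficients $C_{b,\mathbf x,\mathbf y}\in\mathbb C$ are deterministic and satisfy: (1) $|C_{b,\mathbf x,\mathbf y}|\le N^{C'}$ for a fixed $C'$; (2) for a fixed $\tau>0$, $C_{b,\mathbf x,\mathbf y}=0$ whenever $\max_i\big(|[x_i]-b|_L+|[y_i]-b|_L\big)\ge W^\tau\ell_s$; (3) $\max_b|Y_{s,b}|\prec\Lambda$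 for a deterministic $\Lambda>0$. Let $Z=(Z_{ab})_{a,b\in\mathbb Z_L^2}$ be a deterministic complex matrix. **Conclusion.** There is an absolute constant $C>0$ (in particular independent of $\tau$) such that the following hold, uniformly in $a\in\mathbb Z_L^2$. *Case 1.* If $0\le t<1$ and $Z_{ab}=0$ whenever $|a-b|_L\ge W^\tau\ell_t$, then for every $D>0$ $$\sum_bZ_{ab}\,(Y_{s,b}-\mathbb E Y_{s,b})\prec W^{C\tau}\,\ell_t\,\ell_s\,\max_b|Z_{ab}|\,\Lambda+W^{-D}\max_b|Z_{ab}|.$$ *Case 2.* If $Z_{ab}\prec(1+|a-b|_L)^{-1}$ uniformly in $a,b$, then for every $D>0$ $$\sum_bZ_{ab}\,(Y_{s,b}-\mathbb E Y_{s,b})\prec W^{C\tau}\,\ell_s\,\Lambda+W^{-D}.$$ -/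

import Mathlib

open MeasureTheory ProbabilityTheory Filter

noncomputable section

namespace BandMatrix

/-! ### Geometry: blocks and sites -/

/-- The torus `ℤ_L²` that indexes the blocks. -/
abbrev Blk (L : ℕ) : Type := ZMod L × ZMod L

/-- The torus `ℤ_{WL}²` that indexes the rows and columns of the matrices. -/
abbrev Site (W L : ℕ) : Type := ZMod (W * L) × ZMod (W * L)

/-- The periodic `L¹` norm `|a|_L = |a(1)|_L + |a(2)|_L` on `ℤ_L²`; the periodic distance of `a` and
`b` is `perNorm (a - b)`. -/
def perNorm {L : ℕ} (a : Blk L) : ℕ :=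
  a.1.valMinAbs.natAbs + a.2.valMinAbs.natAbs

/-- The block `[x]` that contains the site `x`. Coordinates are represented by `0, …, WL - 1`, and
the block with coordinates `(a(1), a(2))`, `0 ≤ a(i) < L`, consists of the sites `x` with
`a(i) W ≤ x(i) < (a(i) + 1) W`. -/
def block (W L : ℕ) (x : Site W L) : Blk L :=
  (((x.1.val / W : ℕ) : ZMod L), ((x.2.val / W : ℕ) : ZMod L))

/-! ### The random band matrix -/

/-- The block variance profile `S^{(B)}_{ab} = (1/5) 1(|a - b|_L ≤ 1)`. -/
def SB (L : ℕ) : Matrix (Blk L) (Blk L) ℝ :=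
  Matrix.of fun a b => if perNorm (a - b) ≤ 1 then 1 / 5 else 0

/-- The variance profile `S = S^{(B)} ⊗ S_W`, where all the entries of `S_W` are `W⁻²`. -/
def S (W L : ℕ) : Matrix (Site W L) (Site W L) ℝ :=
  Matrix.of fun x y => SB L (block W L x) (block W L y) * ((W : ℝ) ^ 2)⁻¹

/-- `H` is the Gaussian block band matrix: it is Hermitian, its entries are independent up to the
Hermitian symmetry, they are centered complex Gaussian of variance `E|H_xy|² = S_xy` off the diagonal
(independent real and imaginary parts of variance `S_xy / 2`) and centered real Gaussian of variance
`S_xx` on the diagonal. -/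
structure IsBandMatrix (W L : ℕ) {Ω : Type*} [MeasurableSpace Ω] (P : Measure Ω)
    (H : Ω → Matrix (Site W L) (Site W L) ℂ) : Prop where
  measurable : ∀ x y, Measurable fun ω => H ω x y
  hermitian : ∀ ω, (H ω).IsHermitian
  indep : ∀ T : Set (Site W L × Site W L), (∀ x y, (x, y) ∈ T → (y, x) ∈ T → x = y) →
    iIndepFun (fun (p : T) (ω : Ω) => H ω p.1.1 p.1.2) P
  diag : ∀ x, HasLaw (fun ω => (H ω x x).re) (gaussianReal 0 (S W L x x).toNNReal) P
  offdiag_re : ∀ x y, x ≠ y →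
    HasLaw (fun ω => (H ω x y).re) (gaussianReal 0 (S W L x y / 2).toNNReal) P
  offdiag_im : ∀ x y, x ≠ y →
    HasLaw (fun ω => (H ω x y).im) (gaussianReal 0 (S W L x y / 2).toNNReal) P
  offdiag_indep : ∀ x y, x ≠ y →
    IndepFun (fun ω => (H ω x y).re) (fun ω => (H ω x y).im) P

/-! ### The flow of spectral parameters, resolvents and two-loops -/

/-- `m^{(E)}`: the boundary value at `E ∈ (-2, 2)`, from the upper half plane, of the Stieltjes
transform `(-z + √(z² - 4)) / 2` of the semicircle law. -/
def mE (E : ℝ) : ℂ := (-(E : ℂ) + Complex.I * (Real.sqrt (4 - E ^ 2) : ℂ)) / 2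

/-- `z_t = E + (1 - t) m^{(E)}`. -/
def zt (E t : ℝ) : ℂ := (E : ℂ) + (1 - (t : ℂ)) * mE E

/-- `η_t = Im z_t`. -/
def eta (E t : ℝ) : ℝ := (zt E t).im

/-- `ℓ_t = min(|1 - t|^{-1/2}, L)`, for `t ≠ 1`. -/
def ell (L : ℕ) (t : ℝ) : ℝ := min (|1 - t| ^ (-(1 / 2) : ℝ)) (L : ℝ)

/-- `M_t = W² ℓ_t² η_t`. -/
def Mt (W L : ℕ) (E t : ℝ) : ℝ := (W : ℝ) ^ 2 * ell L t ^ 2 * eta E t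

/-- `G_t(+) = (√t H - z_t)⁻¹` (for `true`) and `G_t(-) = (√t H - z̄_t)⁻¹` (for `false`). -/
def G (W L : ℕ) [NeZero W] [NeZero L] (E t : ℝ) (H : Matrix (Site W L) (Site W L) ℂ) (σ : Bool) :
    Matrix (Site W L) (Site W L) ℂ :=
  ((Real.sqrt t : ℂ) • H - (if σ then zt E t else star (zt E t)) • 1)⁻¹

/-- `(E_a)_{xy} = δ_{xy} W⁻² 1([x] = a)`. -/
def Eblk (W L : ℕ) (a : Blk L) : Matrix (Site W L) (Site W L) ℂ :=
  Matrix.diagonal fun x => if block W L x = a then ((W : ℂ) ^ 2)⁻¹ else 0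

/-- The loop `𝓛_{t,(+,-),(a,b)} = tr (G_t(+) E_a G_t(-) E_b)`. -/
def loop (W L : ℕ) [NeZero W] [NeZero L] (E t : ℝ) (H : Matrix (Site W L) (Site W L) ℂ)
    (a b : Blk L) : ℂ :=
  Matrix.trace (G W L E t H true * Eblk W L a * G W L E t H false * Eblk W L b)

/-- The primitive loop `𝓚_{t,(+,-),(a,b)} = W⁻² |m|² [(1 - t |m|² S^{(B)})⁻¹]_{ab}`, `0 ≤ t < 1`. -/
def primLoop (W L : ℕ) [NeZero L] (E t : ℝ) (a b : Blk L) : ℝ :=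
  ((W : ℝ) ^ 2)⁻¹ * ‖mE E‖ ^ 2 *
    ((1 - (t * ‖mE E‖ ^ 2) • SB L : Matrix (Blk L) (Blk L) ℝ)⁻¹) a b

/-- `Y_{t,b} = ∑_{x,y} C_{b,x,y} ∏_{i=1}^u G_t(σ_i)_{x_i y_i}`. -/
def Ypoly (W L : ℕ) [NeZero W] [NeZero L] (E t : ℝ) {u : ℕ} (σ : Fin u → Bool)
    (coef : Blk L → (Fin u → Site W L) → (Fin u → Site W L) → ℂ)
    (H : Matrix (Site W L) (Site W L) ℂ) (b : Blk L) : ℂ :=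
  ∑ x : Fin u → Site W L, ∑ y : Fin u → Site W L,
    coef b x y * ∏ i, G W L E t H (σ i) (x i) (y i)

/-! ### Stochastic domination -/

/-- `N = W² L²`, as a real number. -/
def size (W L : ℕ) : ℝ := (W : ℝ) ^ 2 * (L : ℝ) ^ 2

/-- `ξ ≺ ζ`, uniformly in the parameter `v ∈ U n`, along a sequence of models of size `N n`. -/
def StochDom {Ω : ℕ → Type*} [∀ n, MeasurableSpace (Ω n)] (P : ∀ n, Measure (Ω n)) (N : ℕ → ℝ)
    {U : ℕ → Type*} (ξ ζ : ∀ n, U n → Ω n → ℝ) : Prop :=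
  ∀ ε : ℝ, 0 < ε → ∀ D : ℝ, 0 < D → ∀ᶠ n in atTop,
    P n (⋃ v, {ω | N n ^ ε * ζ n v ω < ξ n v ω}) ≤ ENNReal.ofReal (N n ^ (-D))

/-- `ξ ≺ ζ` for deterministic families, uniformly in the parameter. -/
def DetDom (N : ℕ → ℝ) {U : ℕ → Type*} (ξ ζ : ∀ n, U n → ℝ) : Prop :=
  ∀ ε : ℝ, 0 < ε → ∀ᶠ n in atTop, ∀ v, ξ n v ≤ N n ^ ε * ζ n v

/-- The local law `‖G_s - m‖_max ≺ M_s^{-1/2}` at the times `s = s n`. -/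
def LocalLaw (W L : ℕ → ℕ) [∀ n, NeZero (W n)] [∀ n, NeZero (L n)]
    {Ω : ℕ → Type*} [∀ n, MeasurableSpace (Ω n)] (P : ∀ n, Measure (Ω n))
    (H : ∀ n, Ω n → Matrix (Site (W n) (L n)) (Site (W n) (L n)) ℂ) (E s : ℕ → ℝ) : Prop :=
  StochDom P (fun n => size (W n) (L n)) (U := fun n => Site (W n) (L n) × Site (W n) (L n))
    (fun n p ω => ‖(G (W n) (L n) (E n) (s n) (H n ω) true - mE (E n) • 1) p.1 p.2‖)
    (fun n _ _ => Mt (W n) (L n) (E n) (s n) ^ (-(1 / 2) : ℝ))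

/-- The decay of the two-loop at the times `s = s n`, for a flow started at the times `r = r n`:
`|𝓛_{s,(+,-),(a,b)} - 𝓚_{s,(+,-),(a,b)}| ≺
  (η_r / η_s)⁴ M_s⁻² exp(-|a - b|_L^{1/2} / ℓ_s^{1/2}) + W^{-D}` for every `D > 0`. -/
def LoopDecay (W L : ℕ → ℕ) [∀ n, NeZero (W n)] [∀ n, NeZero (L n)]
    {Ω : ℕ → Type*} [∀ n, MeasurableSpace (Ω n)] (P : ∀ n, Measure (Ω n))
    (H : ∀ n, Ω n → Matrix (Site (W n) (L n)) (Site (W n) (L n)) ℂ) (E r s : ℕ → ℝ) : Prop :=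
  ∀ D : ℝ, 0 < D →
  StochDom P (fun n => size (W n) (L n)) (U := fun n => Blk (L n) × Blk (L n))
    (fun n p ω => ‖loop (W n) (L n) (E n) (s n) (H n ω) p.1 p.2
      - (primLoop (W n) (L n) (E n) (s n) p.1 p.2 : ℂ)‖)
    (fun n p _ => (eta (E n) (r n) / eta (E n) (s n)) ^ 4 * (Mt (W n) (L n) (E n) (s n) ^ 2)⁻¹
        * Real.exp (-(Real.sqrt (perNorm (p.1 - p.2)) / Real.sqrt (ell (L n) (s n))))
      + (W n : ℝ) ^ (-D))

/-- `∑_b Z_{ab} (Y_b - E Y_b)` as a random variable. -/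
def fluctSum {L : ℕ} [NeZero L] {Ω : Type*} [MeasurableSpace Ω] (P : Measure Ω)
    (Z : Matrix (Blk L) (Blk L) ℂ) (Y : Ω → Blk L → ℂ) (a : Blk L) (ω : Ω) : ℂ :=
  ∑ b, Z a b * (Y ω b - ∫ ω', Y ω' b ∂P)

end BandMatrix

end

/-! The sum behaves like a sum of independent variables, one per region of radius of order `R = W^τ
ℓ_s`, so it fluctuates by about `R Λ (∑_b |Z_ab|²)^{1/2}`.

Locality. The loop `tr (G E_a G† E_b)` is a sum of the non-negative terms `W⁻⁴ |G_xy|²`, so decay of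
the loop gives decay of each resolvent entry. The loop is close to the primitive loop by assumption,
and the primitive loop decays like `exp(-√(1-s) |a-b| / 2)` by a maximum principle for `1 - s
S^{(B)}` (`SB_resolvent_le`). Hence, off an event of tiny probability, `G_xy` is smaller than any
power of `N` once the blocks of `x` and `y` are `R` apart (`LoopDecay.eventually_measure_G_gt_le`).
By the resolvent identity, `Y_b` then changes negligibly when `H` is replaced by its restriction to
the ball of radius `2R` about `b` (`norm_Ypoly_sub_Ypoly_cut_le`).

Independence. Restrictions of `H` to disjoint balls are independent
(`IsBandMatrix.iIndepFun_comp_cut`). The torus is coloured with `O(R²)` colours so that blocks of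
the same colour have disjoint balls.

Concentration. Within a colour class, Hoeffding's inequality applies to the localized and truncated
polynomials, which are bounded by about `Λ`; the class fluctuates by `Λ` times the `ℓ²` norm of the
weights in it. Cauchy-Schwarz over the classes costs the square root of the number of colours, that
is a factor `O(R)` (`measure_norm_sum_centered_gt_le_of_approx`,
`eventually_measure_fluctSum_gt_le`).

Weights. If `Z` has range `W^τ ℓ_t`, the `ℓ²` norm of a row is at most `3 W^τ ℓ_t max |Z|`. If
`|Z_ab| ≺ (1 + |a-b|)⁻¹`, it is `≺ 1`, because in two dimensions the sum of the squares diverges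
only logarithmically. The two sources of `W^τ` in the first case give `C = 2`. -/

noncomputable section

namespace BandMatrix

/-! ### Geometry of the block torus -/

theorem perNorm_neg {L : ℕ} (a : Blk L) : perNorm (-a) = perNorm a := by
  simp [perNorm]

theorem perNorm_sub_comm {L : ℕ} (a b : Blk L) : perNorm (a - b) = perNorm (b - a) := by
  rw [← perNorm_neg, neg_sub]

theorem perNorm_add_le {L : ℕ} (a b : Blk L) : perNorm (a + b) ≤ perNorm a + perNorm b := by
  have h1 := ZMod.natAbs_valMinAbs_add_le a.1 b.1
  have h2 := ZMod.natAbs_valMinAbs_add_le a.2 b.2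
  simp only [perNorm, Prod.fst_add, Prod.snd_add]
  have h3 := Int.natAbs_add_le a.1.valMinAbs b.1.valMinAbs
  have h4 := Int.natAbs_add_le a.2.valMinAbs b.2.valMinAbs
  omega

theorem perNorm_sub_le {L : ℕ} (a b c : Blk L) :
    perNorm (a - c) ≤ perNorm (a - b) + perNorm (b - c) := by
  simpa using perNorm_add_le (a - b) (b - c)

theorem perNorm_le {L : ℕ} [NeZero L] (a : Blk L) : perNorm a ≤ L := by
  have h1 := ZMod.natAbs_valMinAbs_le a.1
  have h2 := ZMod.natAbs_valMinAbs_le a.2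
  unfold perNorm; omega

/-! ### Ball volumes and inverse-distance sums on the torus -/

theorem card_natAbs_valMinAbs_lt_le {L : ℕ} [NeZero L] {R : ℝ} (hR : 1 ≤ R) :
    (((Finset.univ : Finset (ZMod L)).filter
      fun x => (x.valMinAbs.natAbs : ℝ) < R).card : ℝ) ≤ 3 * R := by
  have h : ((Finset.univ : Finset (ZMod L)).filter
      fun x => (x.valMinAbs.natAbs : ℝ) < R).card ≤ (Finset.Icc (-(⌊R⌋₊ : ℤ)) ⌊R⌋₊).card := by
    refine Finset.card_le_card_of_injOn ZMod.valMinAbs ?_ (ZMod.injective_valMinAbs.injOn)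
    intro x hx
    have hx' : (x.valMinAbs.natAbs : ℝ) < R := by simpa using hx
    have := Nat.le_floor hx'.le
    simp only [Finset.coe_Icc, Set.mem_Icc]
    omega
  have h2 : (Finset.Icc (-(⌊R⌋₊ : ℤ)) ⌊R⌋₊).card = 2 * ⌊R⌋₊ + 1 := by
    rw [Int.card_Icc]; omega
  rw [h2] at h
  have h3 : (⌊R⌋₊ : ℝ) ≤ R := Nat.floor_le (by linarith)
  have h4 : ((((Finset.univ : Finset (ZMod L)).filter
      fun x => (x.valMinAbs.natAbs : ℝ) < R).card : ℕ) : ℝ) ≤ 2 * ⌊R⌋₊ + 1 := by exact_mod_cast h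
  linarith

theorem card_perNorm_sub_lt_le {L : ℕ} [NeZero L] (a : Blk L) {R : ℝ} (hR : 1 ≤ R) :
    (((Finset.univ : Finset (Blk L)).filter
      fun b => (perNorm (a - b) : ℝ) < R).card : ℝ) ≤ 9 * R ^ 2 := by
  set T := (Finset.univ : Finset (ZMod L)).filter fun x => (x.valMinAbs.natAbs : ℝ) < R with hT
  have h : ((Finset.univ : Finset (Blk L)).filter
      fun b => (perNorm (a - b) : ℝ) < R).card ≤ (T ×ˢ T).card := by
    refine Finset.card_le_card_of_injOn (fun b => a - b) ?_ (fun x _ y _ h => by simpa using h)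
    intro b hb
    have hb' : (perNorm (a - b) : ℝ) < R := by simpa using hb
    simp only [perNorm, Nat.cast_add] at hb'
    simp only [Finset.coe_product, Set.mem_prod, Finset.mem_coe, hT, Finset.mem_filter,
      Finset.mem_univ, true_and]
    constructor <;> linarith [Nat.cast_nonneg (α := ℝ) (a - b).1.valMinAbs.natAbs,
      Nat.cast_nonneg (α := ℝ) (a - b).2.valMinAbs.natAbs]
  have h1 := card_natAbs_valMinAbs_lt_le (L := L) hR
  rw [Finset.card_product] at h
  have h2 : (((Finset.univ : Finset (Blk L)).filter
      fun b => (perNorm (a - b) : ℝ) < R).card : ℝ) ≤ (T.card : ℝ) * T.card := by exact_mod_cast h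
  have h0 : (0 : ℝ) ≤ T.card := by positivity
  nlinarith

theorem sum_inv_one_add_natAbs_valMinAbs_le {L : ℕ} [NeZero L] :
    ∑ x : ZMod L, (1 + (x.valMinAbs.natAbs : ℝ))⁻¹ ≤ 2 * (1 + Real.log L) := by
  have hL : 0 < L := Nat.pos_of_ne_zero (NeZero.ne L)
  -- The reciprocal at the nearer of the two arcs is at most the sum over both arcs; by reflection
  -- each arc contributes one harmonic sum.
  have h1 : ∀ x : ZMod L, (1 + (x.valMinAbs.natAbs : ℝ))⁻¹ ≤
      (1 + (x.val : ℝ))⁻¹ + (((L - 1 - x.val : ℕ) : ℝ) + 1)⁻¹ := by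
    intro x
    have hx := x.val_lt
    rw [ZMod.valMinAbs_natAbs_eq_min]
    rcases min_choice x.val (L - x.val) with h | h <;> rw [h]
    · have : 0 ≤ (((L - 1 - x.val : ℕ) : ℝ) + 1)⁻¹ := by positivity
      linarith
    · have h3 : 0 ≤ (1 + (x.val : ℝ))⁻¹ := by positivity
      have h4 : (1 + ((L - x.val : ℕ) : ℝ))⁻¹ ≤ (((L - 1 - x.val : ℕ) : ℝ) + 1)⁻¹ := by
        apply inv_anti₀ (by positivity)
        have : ((L - 1 - x.val : ℕ) : ℝ) ≤ ((L - x.val : ℕ) : ℝ) := by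
          exact_mod_cast (by omega)
        linarith
      linarith
  have hval : ∀ f : ℕ → ℝ, ∑ x : ZMod L, f x.val = ∑ i ∈ Finset.range L, f i := by
    intro f
    refine Finset.sum_bij (fun x _ => x.val) (fun x _ => by simpa using x.val_lt)
      (fun x _ y _ h => ZMod.val_injective L h) (fun i hi => ⟨(i : ZMod L), by simp, ?_⟩)
      (fun _ _ => rfl)
    exact ZMod.val_cast_of_lt (by simpa using hi)
  have hH : ∑ i ∈ Finset.range L, ((i : ℝ) + 1)⁻¹ ≤ 1 + Real.log L := by
    have := harmonic_le_one_add_log L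
    simpa [harmonic] using this
  calc ∑ x : ZMod L, (1 + (x.valMinAbs.natAbs : ℝ))⁻¹
      ≤ ∑ x : ZMod L, ((1 + (x.val : ℝ))⁻¹ + (((L - 1 - x.val : ℕ) : ℝ) + 1)⁻¹) :=
        Finset.sum_le_sum fun x _ => h1 x
    _ = ∑ i ∈ Finset.range L, ((i : ℝ) + 1)⁻¹ + ∑ i ∈ Finset.range L, ((i : ℝ) + 1)⁻¹ := by
        rw [hval fun i => ((1 + (i : ℝ))⁻¹ + (((L - 1 - i : ℕ) : ℝ) + 1)⁻¹),
          Finset.sum_add_distrib, Finset.sum_range_reflect (fun i => ((i : ℝ) + 1)⁻¹)]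
        simp [add_comm]
    _ ≤ _ := by linarith

/-- Since `(1 + p + q)² ≥ (1 + p)(1 + q)`, the sum is dominated by a product of one-dimensional
harmonic sums. This yields `log²` instead of the optimal `log`, which is harmless under `≺`. -/
theorem sum_inv_one_add_perNorm_sq_le {L : ℕ} [NeZero L] (a : Blk L) :
    ∑ b : Blk L, ((1 + (perNorm (a - b) : ℝ))⁻¹) ^ 2 ≤ (2 * (1 + Real.log L)) ^ 2 := by
  have h1 := sum_inv_one_add_natAbs_valMinAbs_le (L := L)
  have h0 : 0 ≤ ∑ x : ZMod L, (1 + (x.valMinAbs.natAbs : ℝ))⁻¹ :=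
    Finset.sum_nonneg fun _ _ => by positivity
  calc ∑ b : Blk L, ((1 + (perNorm (a - b) : ℝ))⁻¹) ^ 2
      = ∑ b : Blk L, ((1 + (perNorm b : ℝ))⁻¹) ^ 2 :=
        Fintype.sum_equiv (Equiv.subLeft a) _ _ fun _ => rfl
    _ ≤ ∑ b : Blk L, (1 + (b.1.valMinAbs.natAbs : ℝ))⁻¹ * (1 + (b.2.valMinAbs.natAbs : ℝ))⁻¹ := by
        refine Finset.sum_le_sum fun b _ => ?_
        rw [← mul_inv, inv_pow]
        apply inv_anti₀ (by positivity)
        simp only [perNorm, Nat.cast_add]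
        have := Nat.cast_nonneg (α := ℝ) b.1.valMinAbs.natAbs
        have := Nat.cast_nonneg (α := ℝ) b.2.valMinAbs.natAbs
        nlinarith
    _ = (∑ x : ZMod L, (1 + (x.valMinAbs.natAbs : ℝ))⁻¹) ^ 2 := by
        rw [Fintype.sum_prod_type, sq, Finset.sum_mul_sum]
    _ ≤ _ := by gcongr

/-- A colouring of the circle `ℤ_L` with `2 K` colours; distinct points of the same colour are at
distance at least `K`. -/
def circleColour (L K : ℕ) [NeZero L] [NeZero K] (x : ZMod L) : Fin (2 * K) :=
  if h : x.val < L / K * K then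
    ⟨x.val % K, by have := Nat.mod_lt x.val (NeZero.pos K); omega⟩
  else ⟨K + (x.val - L / K * K), by
    have h1 := x.val_lt
    have h2 := Nat.div_add_mod L K
    have h3 := Nat.mod_lt L (NeZero.pos K)
    rw [mul_comm] at h2
    omega⟩

/-- The first `⌊L/K⌋ K` points are coloured by their residue mod `K`; the fewer than `K` leftover
points get private colours, so that no conflict arises where the circle closes up. -/
theorem le_natAbs_of_circleColour_eq {L K : ℕ} [NeZero L] [NeZero K] {x y : ZMod L}
    (h : circleColour L K x = circleColour L K y) (hne : x ≠ y) :
    K ≤ (x - y).valMinAbs.natAbs := by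
  wlog hlt : y.val ≤ x.val generalizing x y with hw
  · have := hw h.symm hne.symm (by omega)
    rwa [← ZMod.natAbs_valMinAbs_neg, neg_sub] at this
  have hne' : x.val ≠ y.val := fun hv => hne (ZMod.val_injective L hv)
  have hK := NeZero.pos K
  have hqL : L / K * K ≤ L := Nat.div_mul_le_self L K
  have hxl := x.val_lt
  rw [ZMod.valMinAbs_natAbs_eq_min, ZMod.val_sub hlt]
  unfold circleColour at h
  have hmx := Nat.mod_lt x.val hK
  have hmy := Nat.mod_lt y.val hK
  split_ifs at h with h1 h2 h2
  · have hmod : x.val % K = y.val % K := by simpa using h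
    -- The points differ by `K k` with `1 ≤ k < L / K`, so both arcs between them, `K k` and `L - K
    -- k`, have length at least `K`.
    obtain ⟨k, hk⟩ : K ∣ x.val - y.val := (Nat.modEq_iff_dvd' hlt).1 hmod.symm
    have hk0 : 0 < k := Nat.pos_of_ne_zero (by rintro rfl; omega)
    have hkq : k < L / K := by
      have : K * k < K * (L / K) := by rw [mul_comm K (L / K)]; omega
      exact Nat.lt_of_mul_lt_mul_left this
    have h5 : K * 1 ≤ K * k := Nat.mul_le_mul_left K hk0
    have h6 : K * (k + 1) ≤ K * (L / K) := Nat.mul_le_mul_left K hkq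
    rw [mul_comm K (L / K), mul_add] at h6
    rw [hk]
    exact le_min (by omega) (by omega)
  · simp only [Fin.mk.injEq] at h; omega
  · simp only [Fin.mk.injEq] at h; omega
  · simp only [Fin.mk.injEq] at h; omega

/-- A colouring of the torus `ℤ_L²` with `(2 K)²` colours; distinct points of the same colour are at
distance at least `K`. -/
def torusColour (L K : ℕ) [NeZero L] [NeZero K] (a : Blk L) : Fin (2 * K) × Fin (2 * K) :=
  (circleColour L K a.1, circleColour L K a.2)

theorem le_perNorm_of_torusColour_eq {L K : ℕ} [NeZero L] [NeZero K] {a b : Blk L}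
    (h : torusColour L K a = torusColour L K b) (hne : a ≠ b) : K ≤ perNorm (a - b) := by
  simp only [torusColour, Prod.mk.injEq] at h
  unfold perNorm
  by_cases h1 : a.1 = b.1
  · have h2 : a.2 ≠ b.2 := fun h2 => hne (Prod.ext h1 h2)
    exact (le_natAbs_of_circleColour_eq h.2 h2).trans (Nat.le_add_left _ _)
  · exact (le_natAbs_of_circleColour_eq h.1 h1).trans (Nat.le_add_right _ _)

/-! ### Decay of the primitive loop -/

/-- Maximum principle: if `f > 0` satisfies `T f ≤ ρ f` and `|g| ≤ T |g| + h`, then `|g| / f` is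
bounded by the value of `h / ((1 - ρ) f)` at some point. -/
theorem exists_abs_mul_le_of_supersolution {ι : Type*} [Fintype ι] [Nonempty ι]
    {T : ι → ι → ℝ} (hT : ∀ x y, 0 ≤ T x y) {f g h : ι → ℝ} (hf : ∀ x, 0 < f x) {ρ : ℝ}
    (hρ : ρ < 1) (hTf : ∀ x, ∑ y, T x y * f y ≤ ρ * f x)
    (hg : ∀ x, |g x| ≤ ∑ y, T x y * |g y| + h x) :
    ∃ x₀, ∀ x, |g x| * ((1 - ρ) * f x₀) ≤ h x₀ * f x := by
  obtain ⟨x₀, -, hx₀⟩ := Finset.exists_max_image Finset.univ (fun x => |g x| / f x)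
    Finset.univ_nonempty
  refine ⟨x₀, fun x => ?_⟩
  set M := |g x₀| / f x₀ with hM
  have hle : ∀ y, |g y| ≤ M * f y := fun y => by
    have := hx₀ y (Finset.mem_univ y)
    rwa [div_le_iff₀ (hf y)] at this
  have hM0 : 0 ≤ M := div_nonneg (abs_nonneg _) (hf _).le
  have h1 : M * f x₀ ≤ M * (ρ * f x₀) + h x₀ := by
    have h2 : M * f x₀ = |g x₀| := by rw [hM, div_mul_cancel₀ _ (hf x₀).ne']
    calc M * f x₀ ≤ ∑ y, T x₀ y * |g y| + h x₀ := h2 ▸ hg x₀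
      _ ≤ ∑ y, T x₀ y * (M * f y) + h x₀ := by
        gcongr with y; exacts [hT _ _, hle y]
      _ = M * ∑ y, T x₀ y * f y + h x₀ := by
        rw [Finset.mul_sum]; congr 1; exact Finset.sum_congr rfl fun _ _ => by ring
      _ ≤ _ := by gcongr; exact hTf x₀
  have h3 : M * ((1 - ρ) * f x₀) ≤ h x₀ := by linarith
  have h4 : 0 ≤ (1 - ρ) * f x₀ := mul_nonneg (by linarith) (hf _).le
  calc |g x| * ((1 - ρ) * f x₀) ≤ M * f x * ((1 - ρ) * f x₀) := by gcongr; exact hle x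
    _ = M * ((1 - ρ) * f x₀) * f x := by ring
    _ ≤ _ := by gcongr; exact (hf x).le

theorem SB_nonneg {L : ℕ} (a b : Blk L) : 0 ≤ SB L a b := by
  simp only [SB, Matrix.of_apply]; split_ifs <;> norm_num

theorem natAbs_valMinAbs_le_one {L : ℕ} [NeZero L] {x : ZMod L} (h : x.valMinAbs.natAbs ≤ 1) :
    x = 0 ∨ x = 1 ∨ x = -1 := by
  have h1 : x.valMinAbs = 0 ∨ x.valMinAbs = 1 ∨ x.valMinAbs = -1 := by omega
  have h2 := ZMod.coe_valMinAbs x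
  rcases h1 with h1 | h1 | h1 <;> rw [h1] at h2 <;> simp [← h2]

/-- Only an inequality, because for small `L` some of the five neighbours coincide. -/
theorem sum_SB_mul_le {L : ℕ} [NeZero L] {f : Blk L → ℝ} (hf : ∀ x, 0 ≤ f x) (a : Blk L) :
    ∑ b, SB L a b * f b ≤
      1 / 5 * (f a + f (a + (1, 0)) + f (a - (1, 0)) + f (a + (0, 1)) + f (a - (0, 1))) := by
  have h1 : ∀ b, SB L a b * f b ≤ 1 / 5 * ((if b = a then f b else 0) +
      (if b = a + (1, 0) then f b else 0) + (if b = a - (1, 0) then f b else 0) +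
      (if b = a + (0, 1) then f b else 0) + (if b = a - (0, 1) then f b else 0)) := by
    intro b
    have h0 : ∀ c : Blk L, 0 ≤ if b = c then f b else 0 := fun c => by
      split_ifs <;> simp [hf]
    have e0 := h0 a
    have e1 := h0 (a + (1, 0))
    have e2 := h0 (a - (1, 0))
    have e3 := h0 (a + (0, 1))
    have e4 := h0 (a - (0, 1))
    by_cases hb : perNorm (a - b) ≤ 1
    · have hSB : SB L a b = 1 / 5 := by simp only [SB, Matrix.of_apply, if_pos hb]
      rw [hSB]
      have hp : b = a ∨ b = a + (1, 0) ∨ b = a - (1, 0) ∨ b = a + (0, 1) ∨ b = a - (0, 1) := by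
        rw [perNorm_sub_comm] at hb
        unfold perNorm at hb
        obtain ⟨c, rfl⟩ : ∃ c, b = a + c := ⟨b - a, by abel⟩
        rw [add_sub_cancel_left] at hb
        have hz : ∀ {x : ZMod L}, x.valMinAbs.natAbs = 0 → x = 0 := fun {x} h =>
          (ZMod.valMinAbs_eq_zero x).1 (Int.natAbs_eq_zero.1 h)
        obtain h | h : c.1.valMinAbs.natAbs = 0 ∨ c.2.valMinAbs.natAbs = 0 := by omega
        · have hc := hz h
          rcases natAbs_valMinAbs_le_one (x := c.2) (by omega) with h2 | h2 | h2
          · exact .inl (by simp [Prod.ext_iff, hc, h2])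
          · exact .inr (.inr (.inr (.inl (by simp [Prod.ext_iff, hc, h2]))))
          · exact .inr (.inr (.inr (.inr (by simp [Prod.ext_iff, hc, h2, sub_eq_add_neg]))))
        · have hc := hz h
          rcases natAbs_valMinAbs_le_one (x := c.1) (by omega) with h2 | h2 | h2
          · exact .inl (by simp [Prod.ext_iff, hc, h2])
          · exact .inr (.inl (by simp [Prod.ext_iff, hc, h2]))
          · exact .inr (.inr (.inl (by simp [Prod.ext_iff, hc, h2, sub_eq_add_neg])))
      rcases hp with h | h | h | h | h
      · rw [if_pos h] at e0 ⊢; linarith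
      · rw [if_pos h] at e1 ⊢; linarith
      · rw [if_pos h] at e2 ⊢; linarith
      · rw [if_pos h] at e3 ⊢; linarith
      · rw [if_pos h] at e4 ⊢; linarith
    · have hSB : SB L a b = 0 := by simp only [SB, Matrix.of_apply, if_neg hb]
      rw [hSB]; linarith
  refine (Finset.sum_le_sum fun b _ => h1 b).trans (le_of_eq ?_)
  rw [← Finset.mul_sum]
  simp [Finset.sum_add_distrib]

/-- The weight `cosh (θ (x - L / 2))` on the circle. -/
def circleWeight (L : ℕ) (θ : ℝ) (x : ZMod L) : ℝ := Real.cosh (θ * ((x.val : ℝ) - L / 2))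

/-- On the line this is the addition formula, with equality. On the circle the weight has a peak at
`0`, where the inequality still goes in the direction that a supersolution needs. -/
theorem circleWeight_add_one_add_sub_one_le {L : ℕ} [NeZero L] (θ : ℝ) (x : ZMod L) :
    circleWeight L θ (x + 1) + circleWeight L θ (x - 1) ≤
      2 * Real.cosh θ * circleWeight L θ x := by
  have hsucc : ∀ y : ZMod L, ((y + 1).val = y.val + 1 ∧ y.val + 1 < L) ∨
      ((y + 1).val = 0 ∧ y.val + 1 = L) := by
    intro y
    have hy := y.val_lt
    have h : (y + 1).val = (y.val + 1) % L := by
      rw [ZMod.val_add, ZMod.val_one_eq_one_mod, Nat.add_mod_mod]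
    rcases Nat.lt_or_ge (y.val + 1) L with h1 | h1
    · exact .inl ⟨by rw [h, Nat.mod_eq_of_lt h1], h1⟩
    · have : y.val + 1 = L := by omega
      exact .inr ⟨by rw [h, this, Nat.mod_self], this⟩
  have h1 : circleWeight L θ (x + 1) ≤ Real.cosh (θ * ((x.val : ℝ) - L / 2) + θ) := by
    unfold circleWeight
    rcases hsucc x with ⟨h, -⟩ | ⟨h, h'⟩ <;> rw [h]
    · apply le_of_eq; congr 1; push_cast; ring
    · apply le_of_eq
      have : (x.val : ℝ) + 1 = L := by exact_mod_cast h'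
      rw [← Real.cosh_neg]; congr 1; push_cast; rw [← this]; ring
  have h2 : circleWeight L θ (x - 1) ≤ Real.cosh (θ * ((x.val : ℝ) - L / 2) - θ) := by
    unfold circleWeight
    have := hsucc (x - 1)
    rw [sub_add_cancel] at this
    rcases this with ⟨h, -⟩ | ⟨h, h'⟩ <;> rw [h]
    · apply le_of_eq; congr 1; push_cast; ring
    -- Stepping back from `0` lands at distance `|L/2 - 1|` from the centre of the weight, whereas
    -- the line would continue to distance `L/2 + 1`.
    · have h3 : ((x - 1).val : ℝ) + 1 = L := by exact_mod_cast h'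
      have hL : (1 : ℝ) ≤ L := by exact_mod_cast NeZero.one_le
      rw [Real.cosh_le_cosh]
      have e1 : θ * (((x - 1).val : ℝ) - L / 2) = θ * (L / 2 - 1) := by rw [← h3]; ring
      have e2 : θ * (((0 : ℕ) : ℝ) - L / 2) - θ = θ * (-(L / 2 + 1)) := by push_cast; ring
      rw [e1, e2, abs_mul, abs_mul, abs_neg]
      refine mul_le_mul_of_nonneg_left ?_ (abs_nonneg _)
      rw [abs_le, abs_of_nonneg (by positivity)]
      constructor <;> linarith
  calc _ ≤ Real.cosh (θ * ((x.val : ℝ) - L / 2) + θ) + Real.cosh (θ * ((x.val : ℝ) - L / 2) - θ) :=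
        add_le_add h1 h2
    _ = _ := by rw [Real.cosh_add, Real.cosh_sub, circleWeight]; ring

theorem circleWeight_pos {L : ℕ} (θ : ℝ) (x : ZMod L) : 0 < circleWeight L θ x := Real.cosh_pos _

theorem circleWeight_le {L : ℕ} [NeZero L] {θ : ℝ} (hθ : 0 ≤ θ) (x : ZMod L) :
    circleWeight L θ x ≤ 2 * Real.exp (-(θ * x.valMinAbs.natAbs)) * circleWeight L θ 0 := by
  have hx := x.val_lt
  have h1 : |(x.val : ℝ) - L / 2| = L / 2 - x.valMinAbs.natAbs := by
    rw [ZMod.valMinAbs_natAbs_eq_min]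
    rcases Nat.le_total x.val (L - x.val) with h | h
    · rw [min_eq_left h, abs_of_nonpos]
      · ring
      · have : (x.val : ℝ) + x.val ≤ L := by exact_mod_cast (by omega)
        linarith
    · rw [min_eq_right h, abs_of_nonneg, Nat.cast_sub hx.le]
      · ring
      · have : (L : ℝ) ≤ x.val + x.val := by exact_mod_cast (by omega)
        linarith
  have h2 : circleWeight L θ x = Real.cosh (θ * (L / 2 - x.valMinAbs.natAbs)) := by
    rw [← h1, circleWeight, ← Real.cosh_abs, abs_mul, abs_of_nonneg hθ]
  have h3 : 0 ≤ L / 2 - (x.valMinAbs.natAbs : ℝ) := h1 ▸ abs_nonneg _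
  have h4 : circleWeight L θ 0 = Real.cosh (θ * (L / 2)) := by
    rw [circleWeight, ← Real.cosh_neg]; congr 1; simp
  rw [h2, h4]
  have h5 : Real.cosh (θ * (L / 2 - x.valMinAbs.natAbs)) ≤
      Real.exp (θ * (L / 2 - x.valMinAbs.natAbs)) := by
    rw [Real.cosh_eq]
    have : Real.exp (-(θ * (L / 2 - x.valMinAbs.natAbs))) ≤
        Real.exp (θ * (L / 2 - x.valMinAbs.natAbs)) :=
      Real.exp_le_exp.2 (by nlinarith [mul_nonneg hθ h3])
    linarith
  have h6 : Real.exp (θ * (L / 2)) ≤ 2 * Real.cosh (θ * (L / 2)) := by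
    rw [Real.cosh_eq]; linarith [Real.exp_pos (-(θ * (L / 2)))]
  calc _ ≤ Real.exp (θ * (L / 2 - x.valMinAbs.natAbs)) := h5
    _ = Real.exp (-(θ * x.valMinAbs.natAbs)) * Real.exp (θ * (L / 2)) := by
      rw [← Real.exp_add]; congr 1; ring
    _ ≤ Real.exp (-(θ * x.valMinAbs.natAbs)) * (2 * Real.cosh (θ * (L / 2))) := by gcongr
    _ = _ := by ring

theorem cosh_le_one_add_sq {x : ℝ} (h0 : 0 ≤ x) (h1 : x ≤ 1) : Real.cosh x ≤ 1 + x ^ 2 := by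
  have h2 := Real.cosh_le_exp_half_sq x
  have h3 : Real.exp (x ^ 2 / 2) ≤ 1 / (1 - x ^ 2 / 2) := by
    apply Real.exp_bound_div_one_sub_of_interval <;> nlinarith
  have h4 : 1 / (1 - x ^ 2 / 2) ≤ 1 + x ^ 2 := by
    rw [div_le_iff₀ (by nlinarith)]
    nlinarith [mul_nonneg (sq_nonneg x) (sub_nonneg.2 (pow_le_one₀ h0 h1 (n := 2)))]
  linarith

/-- A column of the inverse solves `g = t S^{(B)} g + δ_b`. Comparison with a cosh weight of rate `θ
= √(1-t)` in one coordinate, peaked at `b`, gives exponential decay in that coordinate; `θ² = 1 - t`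
is small enough for the weight to remain a supersolution with gap of order `1 - t`. -/
theorem SB_resolvent_le {L : ℕ} [NeZero L] {t : ℝ} (ht0 : 0 ≤ t) (ht1 : t < 1) (a b : Blk L) :
    |((1 - t • SB L : Matrix (Blk L) (Blk L) ℝ)⁻¹) a b| ≤
      4 / (1 - t) * Real.exp (-(Real.sqrt (1 - t) / 2 * perNorm (a - b))) := by
  set θ := Real.sqrt (1 - t) with hθ
  have hθ0 : 0 ≤ θ := Real.sqrt_nonneg _
  have hθ1 : θ ≤ 1 := Real.sqrt_le_one.2 (by linarith)
  have hθ2 : θ ^ 2 = 1 - t := Real.sq_sqrt (by linarith)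
  have hcosh := cosh_le_one_add_sq hθ0 hθ1
  set ρ := t * ((3 + 2 * Real.cosh θ) / 5) with hρ
  -- From `cosh θ ≤ 1 + θ²` one gets `ρ ≤ t + 2 t (1 - t) / 5`, so `1 - ρ ≥ 3 (1 - t) / 5`.
  have hρ1 : (1 - t) / 2 ≤ 1 - ρ := by
    have : ρ ≤ t * ((3 + 2 * (1 + θ ^ 2)) / 5) := by rw [hρ]; gcongr
    rw [hθ2] at this
    nlinarith [mul_nonneg ht0 (sub_nonneg.2 ht1.le)]
  have hρ' : ρ < 1 := by linarith
  set T : Blk L → Blk L → ℝ := fun x y => t * SB L x y with hT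
  have hT0 : ∀ x y, 0 ≤ T x y := fun x y => mul_nonneg ht0 (SB_nonneg x y)
  have hsup : ∀ (c : Blk L), (∀ x, ∑ y, T x y * circleWeight L θ (y - c).1 ≤
      ρ * circleWeight L θ (x - c).1) ∧ (∀ x, ∑ y, T x y * circleWeight L θ (y - c).2 ≤
      ρ * circleWeight L θ (x - c).2) := by
    intro c
    constructor <;> intro x
    · have h1 := sum_SB_mul_le (f := fun y : Blk L => circleWeight L θ (y - c).1)
        (fun _ => (circleWeight_pos _ _).le) x
      have h2 := circleWeight_add_one_add_sub_one_le θ (x - c).1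
      simp only [Prod.fst_sub, Prod.fst_add, add_zero, sub_zero] at h1 h2
      rw [show x.1 + 1 - c.1 = x.1 - c.1 + 1 by ring,
        show x.1 - 1 - c.1 = x.1 - c.1 - 1 by ring] at h1
      simp only [hT, mul_assoc, ← Finset.mul_sum, Prod.fst_sub, hρ]
      refine mul_le_mul_of_nonneg_left ?_ ht0
      linarith
    · have h1 := sum_SB_mul_le (f := fun y : Blk L => circleWeight L θ (y - c).2)
        (fun _ => (circleWeight_pos _ _).le) x
      have h2 := circleWeight_add_one_add_sub_one_le θ (x - c).2
      simp only [Prod.snd_sub, Prod.snd_add, add_zero, sub_zero] at h1 h2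
      rw [show x.2 + 1 - c.2 = x.2 - c.2 + 1 by ring,
        show x.2 - 1 - c.2 = x.2 - c.2 - 1 by ring] at h1
      simp only [hT, mul_assoc, ← Finset.mul_sum, Prod.snd_sub, hρ]
      refine mul_le_mul_of_nonneg_left ?_ ht0
      linarith
  have hmulVec : ∀ (g : Blk L → ℝ) x, ((1 - t • SB L : Matrix (Blk L) (Blk L) ℝ).mulVec g) x =
      g x - ∑ y, T x y * g y := by
    intro g x
    rw [Matrix.sub_mulVec, Matrix.one_mulVec, Pi.sub_apply]
    simp [Matrix.mulVec, dotProduct, hT]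
  have habs : ∀ (g h : Blk L → ℝ), (∀ x, g x - ∑ y, T x y * g y = h x) →
      ∀ x, |g x| ≤ ∑ y, T x y * |g y| + |h x| := by
    intro g h hgh x
    have : g x = ∑ y, T x y * g y + h x := by rw [← hgh]; ring
    rw [this]
    refine (abs_add_le _ _).trans (add_le_add_left ((Finset.abs_sum_le_sum_abs _ _).trans ?_) _)
    exact Finset.sum_le_sum fun y _ => by rw [abs_mul, abs_of_nonneg (hT0 x y)]
  set A := (1 - t • SB L : Matrix (Blk L) (Blk L) ℝ) with hA
  -- A kernel vector satisfies the maximum principle with zero source, hence vanishes.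
  have hdet : IsUnit A.det := by
    rw [isUnit_iff_ne_zero]
    intro hdet
    obtain ⟨v, hv0, hv⟩ := Matrix.exists_mulVec_eq_zero_iff.2 hdet
    obtain ⟨x₀, hx₀⟩ := exists_abs_mul_le_of_supersolution hT0
      (f := fun x => circleWeight L θ (x - 0).1) (g := v) (h := fun x => |(0 : ℝ)|)
      (fun _ => circleWeight_pos _ _) hρ' (hsup 0).1
      (habs v (fun _ => 0) fun x => by rw [← hmulVec, hv]; rfl)
    apply hv0
    ext x
    have h1 := hx₀ x
    have h2 : 0 < (1 - ρ) * circleWeight L θ (x₀ - 0).1 :=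
      mul_pos (by linarith) (circleWeight_pos _ _)
    simp only [abs_zero, zero_mul] at h1
    have : |v x| ≤ 0 := nonpos_of_mul_nonpos_left h1 h2
    simpa using this
  set g : Blk L → ℝ := fun x => A⁻¹ x b with hg
  have hgb : ∀ x, g x - ∑ y, T x y * g y = if x = b then 1 else 0 := by
    intro x
    rw [← hmulVec]
    have := congrFun (congrFun (Matrix.mul_nonsing_inv A hdet) x) b
    rw [Matrix.one_apply] at this
    rw [← this]; rfl
  have key : ∀ f : Blk L → ℝ, (∀ x, 0 < f x) → (∀ x, ∑ y, T x y * f y ≤ ρ * f x) →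
      |g a| * ((1 - ρ) * f b) ≤ f a := by
    intro f hf hTf
    obtain ⟨x₀, hx₀⟩ := exists_abs_mul_le_of_supersolution hT0 hf hρ' hTf (habs g _ hgb)
    -- The source is supported at `b`: if the maximum of `|g| / f` is attained elsewhere, then `g`
    -- vanishes.
    by_cases hxb : x₀ = b
    · subst hxb
      simpa using hx₀ a
    · have h1 := hx₀ a
      have h2 : 0 < (1 - ρ) * f x₀ := mul_pos (by linarith) (hf _)
      simp only [if_neg hxb, abs_zero, zero_mul] at h1
      have h3 : |g a| ≤ 0 := nonpos_of_mul_nonpos_left h1 h2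
      have h4 : |g a| = 0 := le_antisymm h3 (abs_nonneg _)
      rw [h4, zero_mul]; exact (hf a).le
  have fin : ∀ x : ZMod L, |g a| * ((1 - ρ) * circleWeight L θ 0) ≤ circleWeight L θ x →
      |g a| ≤ 4 / (1 - t) * Real.exp (-(θ * x.valMinAbs.natAbs)) := by
    intro x hx
    have h1 := hx.trans (circleWeight_le hθ0 x)
    have h2 := circleWeight_pos θ (0 : ZMod L)
    rw [← mul_assoc] at h1
    have h3 := le_of_mul_le_mul_right h1 h2
    rw [div_mul_eq_mul_div, le_div_iff₀ (by linarith)]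
    nlinarith [abs_nonneg (g a)]
  have f1 := fin (a - b).1 (by
    have := key (fun x => circleWeight L θ (x - b).1) (fun _ => circleWeight_pos _ _) (hsup b).1
    simpa using this)
  have f2 := fin (a - b).2 (by
    have := key (fun x => circleWeight L θ (x - b).2) (fun _ => circleWeight_pos _ _) (hsup b).2
    simpa using this)
  have hc : 0 ≤ 4 / (1 - t) := div_nonneg (by norm_num) (by linarith)
  -- The larger coordinate is at least half of the `L¹` norm, whence the factor `1/2` in the
  -- exponent.
  rcases le_total (a - b).1.valMinAbs.natAbs (a - b).2.valMinAbs.natAbs with h | h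
  · refine f2.trans (mul_le_mul_of_nonneg_left (Real.exp_le_exp.2 ?_) hc)
    have : (perNorm (a - b) : ℝ) ≤ 2 * ((a - b).2.valMinAbs.natAbs : ℝ) := by
      exact_mod_cast (by unfold perNorm; omega)
    nlinarith
  · refine f1.trans (mul_le_mul_of_nonneg_left (Real.exp_le_exp.2 ?_) hc)
    have : (perNorm (a - b) : ℝ) ≤ 2 * ((a - b).1.valMinAbs.natAbs : ℝ) := by
      exact_mod_cast (by unfold perNorm; omega)
    nlinarith

/-! ### Resolvents of Hermitian matrices -/

/-- The matrix `A` with the entries outside of `p × p` replaced by zero. -/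
def cut {ι : Type*} (p : ι → Prop) [DecidablePred p] (A : Matrix ι ι ℂ) : Matrix ι ι ℂ :=
  Matrix.of fun x y => if p x ∧ p y then A x y else 0

theorem cut_isHermitian {ι : Type*} (p : ι → Prop) [DecidablePred p]
    {A : Matrix ι ι ℂ} (hA : A.IsHermitian) : (cut p A).IsHermitian := by
  ext x y
  simp only [cut, Matrix.conjTranspose_apply, Matrix.of_apply]
  by_cases hx : p x <;> by_cases hy : p y <;> simp [hx, hy, hA.apply]

theorem cut_smul {ι : Type*} (p : ι → Prop) [DecidablePred p]
    (c : ℂ) (A : Matrix ι ι ℂ) : cut p (c • A) = c • cut p A := by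
  ext x y
  simp [cut]

section Resolvent

variable {ι : Type*} [Fintype ι] [DecidableEq ι]

theorem im_quadForm_sub_smul_one {A : Matrix ι ι ℂ} (hA : A.IsHermitian) (z : ℂ) (v : ι → ℂ) :
    (star v ⬝ᵥ (A - z • (1 : Matrix ι ι ℂ)).mulVec v).im = -z.im * ∑ x, ‖v x‖ ^ 2 := by
  have h1 : star v ⬝ᵥ v = ((∑ x, ‖v x‖ ^ 2 : ℝ) : ℂ) := by
    simp only [dotProduct, Pi.star_apply, Complex.ofReal_sum]
    refine Finset.sum_congr rfl fun x _ => ?_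
    rw [Complex.star_def, Complex.conj_mul', Complex.ofReal_pow]
  have h2 : (star v ⬝ᵥ A.mulVec v).im = 0 := hA.im_star_dotProduct_mulVec_self v
  rw [Matrix.sub_mulVec, Matrix.smul_mulVec, Matrix.one_mulVec, dotProduct_sub, dotProduct_smul,
    h1, Complex.sub_im, h2, smul_eq_mul, Complex.im_mul_ofReal]
  ring

theorem isUnit_det_sub_smul_one {A : Matrix ι ι ℂ} (hA : A.IsHermitian) {z : ℂ} (hz : z.im ≠ 0) :
    IsUnit (A - z • (1 : Matrix ι ι ℂ)).det := by
  rw [isUnit_iff_ne_zero]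
  intro hdet
  obtain ⟨v, hv0, hv⟩ := Matrix.exists_mulVec_eq_zero_iff.2 hdet
  have h := im_quadForm_sub_smul_one hA z v
  rw [hv, dotProduct_zero, Complex.zero_im] at h
  have h1 : ∑ x, ‖v x‖ ^ 2 = 0 := by
    rcases mul_eq_zero.1 h.symm with h | h
    · exact absurd (neg_eq_zero.1 h) hz
    · exact h
  rw [Finset.sum_eq_zero_iff_of_nonneg fun _ _ => by positivity] at h1
  exact hv0 (funext fun x => by simpa using h1 x (Finset.mem_univ x))

/-- For a column `v` of the inverse, the imaginary part of `⟨v, (A - z) v⟩` gives `|Im z| ∑ |v_x|² ≤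
|v_y|`. This bounds first the diagonal entry `v_y` and then every entry. -/
theorem norm_inv_sub_smul_one_apply_le {A : Matrix ι ι ℂ} (hA : A.IsHermitian) {z : ℂ}
    (hz : z.im ≠ 0) (x y : ι) : ‖(A - z • (1 : Matrix ι ι ℂ))⁻¹ x y‖ ≤ |z.im|⁻¹ := by
  set M := A - z • (1 : Matrix ι ι ℂ)
  have hu : IsUnit M.det := isUnit_det_sub_smul_one hA hz
  set v : ι → ℂ := fun x => M⁻¹ x y with hv
  have h1 : M.mulVec v = Pi.single y 1 := by
    ext w
    have := congrFun (congrFun (Matrix.mul_nonsing_inv M hu) w) y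
    rw [Matrix.one_apply] at this
    rw [Pi.single_apply, ← this]; rfl
  have h2 := im_quadForm_sub_smul_one hA z v
  rw [h1, dotProduct_single_one, Pi.star_apply] at h2
  have hz0 : 0 < |z.im| := abs_pos.2 hz
  have h3 : |z.im| * ∑ x, ‖v x‖ ^ 2 ≤ ‖v y‖ := by
    have h4 : |(star (v y)).im| = |z.im| * ∑ x, ‖v x‖ ^ 2 := by
      have h5 : 0 ≤ ∑ x, ‖v x‖ ^ 2 := Finset.sum_nonneg fun _ _ => by positivity
      rw [h2, abs_mul, abs_neg, abs_of_nonneg h5]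
    rw [← h4]
    simpa using Complex.abs_im_le_norm (star (v y))
  have h5 : ∀ w, |z.im| * ‖v w‖ ^ 2 ≤ ‖v y‖ := fun w =>
    le_trans (mul_le_mul_of_nonneg_left (Finset.single_le_sum
      (f := fun w => ‖v w‖ ^ 2) (fun _ _ => by positivity) (Finset.mem_univ w)) hz0.le) h3
  have h6 : ‖v y‖ ≤ |z.im|⁻¹ := by
    rw [← one_div, le_div_iff₀ hz0]
    by_contra! hlt
    have h7 : 0 < ‖v y‖ := by
      by_contra! h0
      nlinarith [norm_nonneg (v y)]
    nlinarith [h5 y]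
  have h8 := (h5 x).trans h6
  have h9 : |z.im| * |z.im|⁻¹ = 1 := mul_inv_cancel₀ hz0.ne'
  have h10 : 0 < |z.im|⁻¹ := by positivity
  refine le_of_sq_le_sq ?_ h10.le
  calc ‖v x‖ ^ 2 = |z.im|⁻¹ * (|z.im| * ‖v x‖ ^ 2) := by rw [← mul_assoc, mul_comm _ |z.im|, h9, one_mul]
    _ ≤ |z.im|⁻¹ * |z.im|⁻¹ := by gcongr
    _ = _ := by ring

variable (p : ι → Prop) [DecidablePred p]

/-- The cut matrix commutes with the projection onto `p`, and so does its resolvent. -/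
theorem inv_cut_sub_smul_one_apply_eq_zero {A : Matrix ι ι ℂ} (hA : A.IsHermitian) {z : ℂ}
    (hz : z.im ≠ 0) {x w : ι} (hx : p x) (hw : ¬ p w) :
    (cut p A - z • (1 : Matrix ι ι ℂ))⁻¹ x w = 0 := by
  set M := cut p A - z • (1 : Matrix ι ι ℂ) with hM
  have hu : IsUnit M.det := isUnit_det_sub_smul_one (cut_isHermitian p hA) hz
  set Q : Matrix ι ι ℂ := Matrix.diagonal fun x => if p x then 1 else 0 with hQ
  have hcomm : Q * M = M * Q := by
    ext a b
    rw [hQ, Matrix.diagonal_mul, Matrix.mul_diagonal]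
    by_cases hab : a = b
    · subst hab; rw [mul_comm]
    · by_cases ha : p a <;> by_cases hb : p b <;> simp [hM, cut, ha, hb, hab]
  have h1 : Q * M⁻¹ = M⁻¹ * Q := by
    calc Q * M⁻¹ = M⁻¹ * M * (Q * M⁻¹) := by rw [Matrix.nonsing_inv_mul _ hu, Matrix.one_mul]
      _ = M⁻¹ * (M * Q) * M⁻¹ := by simp only [Matrix.mul_assoc]
      _ = M⁻¹ * Q * (M * M⁻¹) := by rw [← hcomm]; simp only [Matrix.mul_assoc]
      _ = M⁻¹ * Q := by rw [Matrix.mul_nonsing_inv _ hu, Matrix.mul_one]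
  have h2 := congrFun (congrFun h1 x) w
  rw [hQ, Matrix.diagonal_mul, Matrix.mul_diagonal] at h2
  simpa [hx, hw] using h2

/-- In the resolvent identity with the cut resolvent on the left, the first intermediate index
cannot leave `p`, and the difference `cut p A - A` then forces the second one out of `p`, where the
full resolvent is at most `q`. -/
theorem norm_inv_sub_inv_cut_apply_le {A : Matrix ι ι ℂ} (hA : A.IsHermitian) {z : ℂ}
    (hz : z.im ≠ 0) {g h q : ℝ} (hg : |z.im|⁻¹ ≤ g) (hh : ∀ x y, ‖A x y‖ ≤ h) (hq0 : 0 ≤ q)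
    {x y : ι} (hx : p x) (hq : ∀ w, ¬ p w → ‖(A - z • (1 : Matrix ι ι ℂ))⁻¹ w y‖ ≤ q) :
    ‖(A - z • (1 : Matrix ι ι ℂ))⁻¹ x y - (cut p A - z • (1 : Matrix ι ι ℂ))⁻¹ x y‖ ≤
      (Fintype.card ι : ℝ) ^ 2 * (g * h * q) := by
  set M := A - z • (1 : Matrix ι ι ℂ) with hM
  set M' := cut p A - z • (1 : Matrix ι ι ℂ) with hM'
  have hu : IsUnit M.det := isUnit_det_sub_smul_one hA hz
  have hu' : IsUnit M'.det := isUnit_det_sub_smul_one (cut_isHermitian p hA) hz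
  have hid : M⁻¹ - M'⁻¹ = M'⁻¹ * ((cut p A - A) * M⁻¹) := by
    have : cut p A - A = M' - M := by rw [hM, hM']; abel
    rw [this, Matrix.sub_mul, Matrix.mul_sub, Matrix.mul_nonsing_inv _ hu, Matrix.mul_one,
      ← Matrix.mul_assoc, Matrix.nonsing_inv_mul _ hu', Matrix.one_mul]
  have h0 : 0 ≤ h := (norm_nonneg _).trans (hh x x)
  have hg0 : 0 ≤ g := le_trans (by positivity) hg
  rw [← Matrix.sub_apply, hid, Matrix.mul_apply]
  have hterm : ∀ w w', ‖M'⁻¹ x w * ((cut p A - A) w w' * M⁻¹ w' y)‖ ≤ g * h * q := by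
    intro w w'
    by_cases hw : p w
    · by_cases hw' : p w'
      · simp only [cut, Matrix.sub_apply, Matrix.of_apply, hw, hw', and_self, if_true, sub_self,
          zero_mul, mul_zero, norm_zero]
        positivity
      · rw [norm_mul, norm_mul, mul_assoc]
        have h1 : ‖M'⁻¹ x w‖ ≤ g :=
          (norm_inv_sub_smul_one_apply_le (cut_isHermitian p hA) hz x w).trans hg
        have h2 : ‖(cut p A - A) w w'‖ ≤ h := by
          simp only [cut, Matrix.sub_apply, Matrix.of_apply, hw', and_false, if_false, zero_sub,
            norm_neg]
          exact hh w w'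
        gcongr
        exact hq w' hw'
    · rw [inv_cut_sub_smul_one_apply_eq_zero p hA hz hx hw, zero_mul, norm_zero]
      positivity
  calc ‖∑ w, M'⁻¹ x w * ((cut p A - A) * M⁻¹) w y‖
      ≤ ∑ w, ∑ w', ‖M'⁻¹ x w * ((cut p A - A) w w' * M⁻¹ w' y)‖ := by
        refine (norm_sum_le _ _).trans (Finset.sum_le_sum fun w _ => ?_)
        rw [Matrix.mul_apply, Finset.mul_sum]
        exact norm_sum_le _ _
    _ ≤ ∑ _w : ι, ∑ _w' : ι, g * h * q :=
        Finset.sum_le_sum fun w _ => Finset.sum_le_sum fun w' _ => hterm w w'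
    _ = _ := by simp; ring

theorem measurable_inv_apply {Ω : Type*} [MeasurableSpace Ω] {M : Ω → Matrix ι ι ℂ}
    (hM : ∀ x y, Measurable fun ω => M ω x y) (x y : ι) : Measurable fun ω => (M ω)⁻¹ x y := by
  have hdet : ∀ N : Ω → Matrix ι ι ℂ, (∀ x y, Measurable fun ω => N ω x y) →
      Measurable fun ω => (N ω).det := by
    intro N hN
    simp only [Matrix.det_apply']
    exact Finset.measurable_fun_sum _ fun i _ =>
      (Finset.measurable_fun_prod _ fun j _ => hN _ _).const_mul _
  simp only [Matrix.inv_def, Matrix.smul_apply, Ring.inverse_eq_inv', Matrix.adjugate_apply,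
    smul_eq_mul]
  refine (hdet M hM).inv.mul (hdet _ fun a b => ?_)
  simp only [Matrix.updateRow_apply]
  split_ifs
  · exact measurable_const
  · exact hM a b

end Resolvent

theorem norm_prod_sub_prod_le {u : ℕ} {f f' : Fin u → ℂ} {g e : ℝ} (hg : 1 ≤ g)
    (hf : ∀ i, ‖f i‖ ≤ g) (hf' : ∀ i, ‖f' i‖ ≤ g) (he : ∀ i, ‖f i - f' i‖ ≤ e) :
    ‖∏ i, f i - ∏ i, f' i‖ ≤ u * (g ^ u * e) := by
  induction u with
  | zero => simp
  | succ u ih =>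
    have he0 : 0 ≤ e := (norm_nonneg _).trans (he 0)
    rw [Fin.prod_univ_succ, Fin.prod_univ_succ]
    have h1 := ih (f := fun i => f i.succ) (f' := fun i => f' i.succ) (fun i => hf _)
      (fun i => hf' _) (fun i => he _)
    have h2 : ‖∏ i : Fin u, f' i.succ‖ ≤ g ^ u := by
      rw [norm_prod]
      calc ∏ i : Fin u, ‖f' i.succ‖ ≤ ∏ _i : Fin u, g :=
            Finset.prod_le_prod (fun _ _ => norm_nonneg _) fun i _ => hf' _
        _ = g ^ u := by simp
    have h3 : f 0 * ∏ i : Fin u, f i.succ - f' 0 * ∏ i : Fin u, f' i.succ =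
        f 0 * (∏ i : Fin u, f i.succ - ∏ i : Fin u, f' i.succ) +
          (f 0 - f' 0) * ∏ i : Fin u, f' i.succ := by ring
    rw [h3]
    refine (norm_add_le _ _).trans ?_
    rw [norm_mul, norm_mul]
    have h4 : ‖f 0‖ * ‖∏ i : Fin u, f i.succ - ∏ i : Fin u, f' i.succ‖ ≤
        g * (u * (g ^ u * e)) := by gcongr; exact hf 0
    have h5 : ‖f 0 - f' 0‖ * ‖∏ i : Fin u, f' i.succ‖ ≤ e * g ^ u := by gcongr; exact he 0
    have h6 : e * g ^ u ≤ g ^ (u + 1) * e := by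
      rw [pow_succ, mul_comm e]
      have : 0 ≤ g ^ u := by positivity
      nlinarith [mul_nonneg this he0]
    push_cast
    calc _ ≤ g * (u * (g ^ u * e)) + g ^ (u + 1) * e := by linarith
      _ = _ := by ring

/-! ### Independence of functions of disjoint blocks of the matrix -/

/-- If the random variables `X i j` are jointly independent, then the families `(X i j)_j` are
independent. -/
theorem iIndepFun_curry {Ω : Type*} [MeasurableSpace Ω] {P : Measure Ω} [IsProbabilityMeasure P]
    {ι : Type*} {κ : ι → Type*} {𝓧 : Type*} [MeasurableSpace 𝓧] {X : (i : ι) → κ i → Ω → 𝓧}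
    (mX : ∀ i j, Measurable (X i j))
    (h : iIndepFun (fun (p : (i : ι) × κ i) ω => X p.1 p.2 ω) P) :
    iIndepFun (fun i ω (j : κ i) => X i j ω) P := by
  have : ∀ i j, IsProbabilityMeasure (P.map (X i j)) :=
    fun i j => Measure.isProbabilityMeasure_map (mX i j).aemeasurable
  have hc : (MeasurableEquiv.piCurry fun (i : ι) (_ : κ i) => 𝓧) ∘ (fun ω p => X p.1 p.2 ω) =
      fun ω i j => X i j ω := by
    ext; simp [Sigma.curry]
  have h2 : ∀ i, iIndepFun (X i) P := fun i =>
    h.precomp (g := fun j : κ i => (⟨i, j⟩ : (i : ι) × κ i)) fun j j' hj => by simpa using hj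
  rw [iIndepFun_iff_map_fun_eq_infinitePi_map (by fun_prop), ← hc,
    ← Measure.map_map (by fun_prop) (by fun_prop),
    (iIndepFun_iff_map_fun_eq_infinitePi_map (by fun_prop)).1 h,
    Measure.infinitePi_map_piCurry (fun i j => P.map (X i j))]
  congrm Measure.infinitePi fun i => ?_
  rw [(iIndepFun_iff_map_fun_eq_infinitePi_map (by fun_prop)).1 (h2 i)]

section Cut

variable {W L : ℕ} [NeZero W] [NeZero L] {Ω : Type*} [MeasurableSpace Ω] {P : Measure Ω}
  [IsProbabilityMeasure P] {H : Ω → Matrix (Site W L) (Site W L) ℂ}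

/-- Order the sites and keep the upper triangle: its entries are independent, disjoint regions use
disjoint sets of them, and each cut matrix is recovered from its own set by Hermitian symmetry.
Hypothesis `hF` expresses the measurability of `F b` entrywise. -/
theorem IsBandMatrix.iIndepFun_comp_cut (hH : IsBandMatrix W L P H) {β : Type*}
    (p : β → Site W L → Prop) [∀ b, DecidablePred (p b)]
    (hp : ∀ b b' x, p b x → p b' x → b = b')
    (F : β → Matrix (Site W L) (Site W L) ℂ → ℂ)
    (hF : ∀ b (Ω' : Type) [MeasurableSpace Ω'] (M : Ω' → Matrix (Site W L) (Site W L) ℂ),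
      (∀ x y, Measurable fun ω => M ω x y) → Measurable fun ω => F b (M ω)) :
    iIndepFun (fun b ω => F b (cut (p b) (H ω))) P := by
  let e := Fintype.equivFin (Site W L)
  let T : Set (Site W L × Site W L) := {q | e q.1 ≤ e q.2}
  have hT := hH.indep T fun x y h1 h2 => e.injective (le_antisymm h1 h2)
  let κ : β → Type := fun b => {q : Site W L × Site W L // e q.1 ≤ e q.2 ∧ p b q.1 ∧ p b q.2}
  have h1 : iIndepFun (fun (q : (b : β) × κ b) ω => H ω q.2.1.1 q.2.1.2) P := by
    refine hT.precomp (g := fun q : (b : β) × κ b => (⟨q.2.1, q.2.2.1⟩ : T)) ?_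
    rintro ⟨b, q, hq⟩ ⟨b', q', hq'⟩ h
    have h' : q = q' := by simpa using h
    subst h'
    obtain rfl := hp b b' q.1 hq.2.1 hq'.2.1
    rfl
  have h2 := iIndepFun_curry (X := fun b (q : κ b) ω => H ω q.1.1 q.1.2)
    (fun b q => hH.measurable _ _) h1
  let rec' : ∀ b, (κ b → ℂ) → Matrix (Site W L) (Site W L) ℂ := fun b v => Matrix.of fun x y =>
    if h : p b x ∧ p b y then
      if hxy : e x ≤ e y then v ⟨(x, y), hxy, h.1, h.2⟩
      else star (v ⟨(y, x), (le_total _ _).resolve_left hxy, h.2, h.1⟩)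
    else 0
  have hrec : ∀ b x y, Measurable fun v => rec' b v x y := by
    intro b x y
    simp only [rec', Matrix.of_apply]
    split_ifs with h hxy
    · exact measurable_pi_apply _
    · exact Complex.continuous_conj.measurable.comp (measurable_pi_apply _)
    · exact measurable_const
  have h3 := h2.comp (fun b v => F b (rec' b v)) fun b => hF b _ _ (hrec b)
  convert h3 using 3 with b ω
  simp only [Function.comp_apply]
  congr 1
  ext x y
  simp only [cut, rec', Matrix.of_apply]
  split_ifs with h hxy
  · rfl
  · rw [(hH.hermitian ω).apply]
  · rfl

end Cut

/-! ### Resolvents of the band matrix and two-loops -/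

theorem mE_im (E : ℝ) : (mE E).im = Real.sqrt (4 - E ^ 2) / 2 := by
  unfold mE
  rw [show (2 : ℂ) = ((2 : ℝ) : ℂ) by norm_num, Complex.div_ofReal_im]
  simp

theorem mE_re (E : ℝ) : (mE E).re = -E / 2 := by
  unfold mE
  rw [show (2 : ℂ) = ((2 : ℝ) : ℂ) by norm_num, Complex.div_ofReal_re]
  simp

theorem norm_mE_sq {E : ℝ} (hE : |E| ≤ 2) : ‖mE E‖ ^ 2 = 1 := by
  have h : 0 ≤ 4 - E ^ 2 := by nlinarith [abs_le.1 hE]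
  rw [Complex.sq_norm, Complex.normSq_apply, mE_im, mE_re]
  nlinarith [Real.sq_sqrt h]

theorem eta_eq (E t : ℝ) : eta E t = (1 - t) * (Real.sqrt (4 - E ^ 2) / 2) := by
  rw [← mE_im]
  simp [eta, zt]

theorem isHermitian_sqrt_smul {W L : ℕ} {H : Matrix (Site W L) (Site W L) ℂ}
    (hH : H.IsHermitian) (t : ℝ) :
    ((Real.sqrt t : ℂ) • H).IsHermitian := by
  rw [Matrix.IsHermitian, Matrix.conjTranspose_smul, hH.eq]
  simp

theorem abs_primLoop_le {W L : ℕ} [NeZero L] (hW1 : 1 ≤ W) {E t : ℝ} (hE : |E| ≤ 2)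
    (ht0 : 0 ≤ t) (ht1 : t < 1)
    (a b : Blk L) : |primLoop W L E t a b| ≤
      4 / (1 - t) * Real.exp (-(Real.sqrt (1 - t) / 2 * perNorm (a - b))) := by
  have h := SB_resolvent_le (L := L) ht0 ht1 a b
  have hW : (1 : ℝ) ≤ (W : ℝ) ^ 2 := one_le_pow₀ (by exact_mod_cast hW1)
  have hW' : |((W : ℝ) ^ 2)⁻¹| ≤ 1 := by
    rw [abs_of_nonneg (by positivity)]; exact inv_le_one_of_one_le₀ hW
  unfold primLoop
  rw [norm_mE_sq hE, mul_one, mul_one, abs_mul]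
  calc _ ≤ 1 * |((1 - t • SB L : Matrix (Blk L) (Blk L) ℝ)⁻¹) a b| := by gcongr
    _ ≤ _ := by rw [one_mul]; exact h

section

variable {W L : ℕ} [NeZero W] [NeZero L]

theorem G_eq (E t : ℝ) (H : Matrix (Site W L) (Site W L) ℂ) (σ : Bool) :
    G W L E t H σ = ((Real.sqrt t : ℂ) • H - (if σ then zt E t else star (zt E t)) • 1)⁻¹ := rfl

theorem abs_im_ite_zt (E t : ℝ) (σ : Bool) :
    |(if σ then zt E t else star (zt E t)).im| = |eta E t| := by
  cases σ <;> simp [eta]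

theorem norm_G_apply_le {E t : ℝ} (hη : 0 < eta E t) {H : Matrix (Site W L) (Site W L) ℂ}
    (hH : H.IsHermitian) (σ : Bool) (x y : Site W L) : ‖G W L E t H σ x y‖ ≤ (eta E t)⁻¹ := by
  have h := norm_inv_sub_smul_one_apply_le (isHermitian_sqrt_smul hH t)
    (z := if σ then zt E t else star (zt E t))
    (by rw [← abs_pos, abs_im_ite_zt, abs_of_pos hη]; exact hη) x y
  rwa [abs_im_ite_zt, abs_of_pos hη] at h

theorem G_false_apply {E t : ℝ} {H : Matrix (Site W L) (Site W L) ℂ} (hH : H.IsHermitian)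
    (x y : Site W L) : G W L E t H false x y = star (G W L E t H true y x) := by
  have h : G W L E t H false = (G W L E t H true).conjTranspose := by
    rw [G_eq, G_eq, Matrix.conjTranspose_nonsing_inv, Matrix.conjTranspose_sub,
      (isHermitian_sqrt_smul hH t).eq, Matrix.conjTranspose_smul]
    simp
  rw [h, Matrix.conjTranspose_apply]

theorem norm_G_false_apply {E t : ℝ} {H : Matrix (Site W L) (Site W L) ℂ} (hH : H.IsHermitian)
    (x y : Site W L) : ‖G W L E t H false x y‖ = ‖G W L E t H true y x‖ := by
  rw [G_false_apply hH, norm_star]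

theorem measurable_G_apply {Ω : Type*} [MeasurableSpace Ω] (E t : ℝ)
    {M : Ω → Matrix (Site W L) (Site W L) ℂ} (hM : ∀ x y, Measurable fun ω => M ω x y) (σ : Bool)
    (x y : Site W L) : Measurable fun ω => G W L E t (M ω) σ x y := by
  refine measurable_inv_apply (fun a b => ?_) x y
  simp only [Matrix.sub_apply, Matrix.smul_apply, smul_eq_mul]
  exact ((hM a b).const_mul _).sub_const _

theorem measurable_Ypoly {Ω : Type*} [MeasurableSpace Ω] (E t : ℝ) {u : ℕ} (σ : Fin u → Bool)
    (coef : Blk L → (Fin u → Site W L) → (Fin u → Site W L) → ℂ)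
    {M : Ω → Matrix (Site W L) (Site W L) ℂ} (hM : ∀ x y, Measurable fun ω => M ω x y) (b : Blk L) :
    Measurable fun ω => Ypoly W L E t σ coef (M ω) b :=
  Finset.measurable_fun_sum _ fun _ _ => Finset.measurable_fun_sum _ fun _ _ =>
    (Finset.measurable_fun_prod _ fun _ _ => measurable_G_apply E t hM _ _ _).const_mul _

theorem loop_eq (E t : ℝ) {H : Matrix (Site W L) (Site W L) ℂ} (hH : H.IsHermitian) (a b : Blk L) :
    loop W L E t H a b = ((∑ x, ∑ y, ‖G W L E t H true x y‖ ^ 2 *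
      ((if block W L y = a then ((W : ℝ) ^ 2)⁻¹ else 0) *
        (if block W L x = b then ((W : ℝ) ^ 2)⁻¹ else 0)) : ℝ) : ℂ) := by
  unfold loop Eblk
  rw [Matrix.trace]
  push_cast
  refine Finset.sum_congr rfl fun x _ => ?_
  rw [Matrix.diag_apply, Matrix.mul_diagonal, Matrix.mul_apply, Finset.sum_mul]
  refine Finset.sum_congr rfl fun y _ => ?_
  rw [Matrix.mul_diagonal, G_false_apply hH, Complex.star_def, ← Complex.mul_conj']
  split_ifs <;> push_cast <;> ring

/-- All terms of the loop are non-negative, so a single one is bounded by the whole; `W⁴` undoes the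
normalization of the two block projections. -/
theorem norm_G_sq_le_loop (E t : ℝ) {H : Matrix (Site W L) (Site W L) ℂ} (hH : H.IsHermitian)
    (x y : Site W L) :
    ‖G W L E t H true x y‖ ^ 2 ≤ (W : ℝ) ^ 4 * ‖loop W L E t H (block W L y) (block W L x)‖ := by
  have hW : (0 : ℝ) < W := by exact_mod_cast NeZero.pos W
  have h0 : ∀ x' y', 0 ≤ ‖G W L E t H true x' y'‖ ^ 2 *
      ((if block W L y' = block W L y then ((W : ℝ) ^ 2)⁻¹ else 0) *
        (if block W L x' = block W L x then ((W : ℝ) ^ 2)⁻¹ else 0)) := fun x' y' => by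
    split_ifs <;> positivity
  rw [loop_eq E t hH, Complex.norm_real, Real.norm_of_nonneg
    (Finset.sum_nonneg fun _ _ => Finset.sum_nonneg fun _ _ => h0 _ _)]
  have h1 := Finset.single_le_sum (f := fun x' => ∑ y', ‖G W L E t H true x' y'‖ ^ 2 *
      ((if block W L y' = block W L y then ((W : ℝ) ^ 2)⁻¹ else 0) *
        (if block W L x' = block W L x then ((W : ℝ) ^ 2)⁻¹ else 0)))
    (fun _ _ => Finset.sum_nonneg fun _ _ => h0 _ _) (Finset.mem_univ x)
  have h2 := Finset.single_le_sum (f := fun y' => ‖G W L E t H true x y'‖ ^ 2 *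
      ((if block W L y' = block W L y then ((W : ℝ) ^ 2)⁻¹ else 0) *
        (if block W L x = block W L x then ((W : ℝ) ^ 2)⁻¹ else 0)))
    (fun _ _ => h0 _ _) (Finset.mem_univ y)
  have h3 := h2.trans h1
  simp only [if_true] at h3
  calc ‖G W L E t H true x y‖ ^ 2
      = (W : ℝ) ^ 4 * (‖G W L E t H true x y‖ ^ 2 * (((W : ℝ) ^ 2)⁻¹ * ((W : ℝ) ^ 2)⁻¹)) := by
        field_simp
    _ ≤ _ := by gcongr

theorem norm_Ypoly_le {E t : ℝ} {u : ℕ} {σ : Fin u → Bool}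
    {coef : Blk L → (Fin u → Site W L) → (Fin u → Site W L) → ℂ} {B g : ℝ}
    (hη : 0 < eta E t) (hg : (eta E t)⁻¹ ≤ g) (hcoef : ∀ b x y, ‖coef b x y‖ ≤ B)
    {H : Matrix (Site W L) (Site W L) ℂ} (hH : H.IsHermitian) (b : Blk L) :
    ‖Ypoly W L E t σ coef H b‖ ≤ (Fintype.card (Fin u → Site W L) : ℝ) ^ 2 * (B * g ^ u) := by
  have hterm : ∀ x y, ‖coef b x y * ∏ i, G W L E t H (σ i) (x i) (y i)‖ ≤ B * g ^ u := by
    intro x y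
    rw [norm_mul, norm_prod]
    have h1 : ∏ i, ‖G W L E t H (σ i) (x i) (y i)‖ ≤ ∏ _i : Fin u, g :=
      Finset.prod_le_prod (fun _ _ => norm_nonneg _) fun i _ =>
        (norm_G_apply_le hη hH _ _ _).trans hg
    rw [Finset.prod_const, Finset.card_univ, Fintype.card_fin] at h1
    exact mul_le_mul (hcoef _ _ _) h1 (Finset.prod_nonneg fun _ _ => norm_nonneg _)
      ((norm_nonneg _).trans (hcoef b x y))
  calc _ ≤ ∑ x : Fin u → Site W L, ∑ y : Fin u → Site W L,
        ‖coef b x y * ∏ i, G W L E t H (σ i) (x i) (y i)‖ :=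
        (norm_sum_le _ _).trans (Finset.sum_le_sum fun _ _ => norm_sum_le _ _)
    _ ≤ ∑ _x : Fin u → Site W L, ∑ _y : Fin u → Site W L, B * g ^ u :=
        Finset.sum_le_sum fun _ _ => Finset.sum_le_sum fun _ _ => hterm _ _
    _ = _ := by simp only [Finset.sum_const, Finset.card_univ, nsmul_eq_mul]; ring

/-- Replacing `H` by its restriction to the ball of radius `2 R` about the block `b` hardly changes
`Y_b`, if the resolvent is small at distances larger than `R`. -/
theorem norm_Ypoly_sub_Ypoly_cut_le {E t : ℝ} (ht1 : t ≤ 1) {u : ℕ} {σ : Fin u → Bool}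
    {coef : Blk L → (Fin u → Site W L) → (Fin u → Site W L) → ℂ} {B g h q R : ℝ}
    (hη : 0 < eta E t) (hg1 : 1 ≤ g) (hg : (eta E t)⁻¹ ≤ g) (hB : 0 ≤ B)
    (hcoef : ∀ b x y, ‖coef b x y‖ ≤ B)
    (hloc : ∀ b x y, (∃ i, R ≤ (perNorm (block W L (x i) - b) : ℝ) +
      (perNorm (block W L (y i) - b) : ℝ)) → coef b x y = 0)
    {H : Matrix (Site W L) (Site W L) ℂ} (hH : H.IsHermitian) (hh : ∀ x y, ‖H x y‖ ≤ h)
    (hq0 : 0 ≤ q) (hq : ∀ x y, R ≤ (perNorm (block W L x - block W L y) : ℝ) →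
      ‖G W L E t H true x y‖ ≤ q) (b : Blk L)
    (p : Site W L → Prop) [DecidablePred p]
    (hp : ∀ x, p x ↔ (perNorm (block W L x - b) : ℝ) < 2 * R) :
    ‖Ypoly W L E t σ coef H b -
      Ypoly W L E t σ coef (cut p H) b‖ ≤
      (Fintype.card (Fin u → Site W L) : ℝ) ^ 2 * (B * (u * (g ^ u *
        ((Fintype.card (Site W L) : ℝ) ^ 2 * (g * h * q))))) := by
  set e := (Fintype.card (Site W L) : ℝ) ^ 2 * (g * h * q) with he
  have h0 : 0 ≤ h := (norm_nonneg _).trans (hh 0 0)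
  have he0 : 0 ≤ e := by positivity
  have hG : ∀ (τ : Bool) x y, (perNorm (block W L x - b) : ℝ) + perNorm (block W L y - b) < R →
      ‖G W L E t H τ x y - G W L E t (cut p H) τ x y‖ ≤ e := by
    intro τ x y hxy
    have hx0 : (0 : ℝ) ≤ perNorm (block W L x - b) := by positivity
    have hy0 : (0 : ℝ) ≤ perNorm (block W L y - b) := by positivity
    rw [G_eq, G_eq, ← cut_smul]
    have hz : |(if τ then zt E t else star (zt E t)).im| = eta E t := by
      rw [abs_im_ite_zt, abs_of_pos hη]
    refine norm_inv_sub_inv_cut_apply_le p (isHermitian_sqrt_smul hH t)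
      (by rw [← abs_pos, hz]; exact hη) (by rw [hz]; exact hg) (fun a c => ?_) hq0
      ((hp x).2 (by linarith)) (fun w hw => ?_)
    · rw [Matrix.smul_apply, norm_smul, Complex.norm_real,
        Real.norm_of_nonneg (Real.sqrt_nonneg _)]
      calc _ ≤ 1 * ‖H a c‖ := by gcongr; exact Real.sqrt_le_one.2 ht1
        _ ≤ h := by rw [one_mul]; exact hh a c
    -- Here `w` is outside the ball of radius `2R` and `y` is within `R` of `b`, so they are at
    -- least `R` apart.
    · have hw' : 2 * R ≤ (perNorm (block W L w - b) : ℝ) :=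
        not_lt.1 fun hlt => hw ((hp w).2 hlt)
      have htri : (perNorm (block W L w - b) : ℝ) ≤
          perNorm (block W L w - block W L y) + perNorm (block W L y - b) := by
        exact_mod_cast perNorm_sub_le _ _ _
      rw [← G_eq]
      cases τ
      · rw [norm_G_false_apply hH]
        exact hq _ _ (by rw [perNorm_sub_comm]; linarith)
      · exact hq _ _ (by linarith)
  have hterm : ∀ x y : Fin u → Site W L, ‖coef b x y * ∏ i, G W L E t H (σ i) (x i) (y i) -
      coef b x y * ∏ i, G W L E t (cut p H) (σ i) (x i) (y i)‖ ≤ B * (u * (g ^ u * e)) := by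
    intro x y
    by_cases hxy : ∃ i, R ≤ (perNorm (block W L (x i) - b) : ℝ) +
      (perNorm (block W L (y i) - b) : ℝ)
    · rw [hloc b x y hxy, zero_mul, zero_mul, sub_zero, norm_zero]
      positivity
    · push Not at hxy
      rw [← mul_sub, norm_mul]
      refine mul_le_mul (hcoef _ _ _) (norm_prod_sub_prod_le hg1
        (fun i => (norm_G_apply_le hη hH _ _ _).trans hg)
        (fun i => (norm_G_apply_le hη (cut_isHermitian p hH) _ _ _).trans hg)
        fun i => hG _ _ _ (hxy i)) (norm_nonneg _) hB
  unfold Ypoly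
  rw [← Finset.sum_sub_distrib]
  simp_rw [← Finset.sum_sub_distrib]
  calc _ ≤ ∑ x : Fin u → Site W L, ∑ y : Fin u → Site W L,
        ‖coef b x y * ∏ i, G W L E t H (σ i) (x i) (y i) -
          coef b x y * ∏ i, G W L E t (cut p H) (σ i) (x i) (y i)‖ :=
        (norm_sum_le _ _).trans (Finset.sum_le_sum fun _ _ => norm_sum_le _ _)
    _ ≤ ∑ _x : Fin u → Site W L, ∑ _y : Fin u → Site W L, B * (u * (g ^ u * e)) :=
        Finset.sum_le_sum fun _ _ => Finset.sum_le_sum fun _ _ => hterm _ _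
    _ = _ := by simp only [Finset.sum_const, Finset.card_univ, nsmul_eq_mul]; ring

end

/-! ### Tails of the matrix entries -/

theorem measure_gaussian_tail_le {Ω : Type*} [MeasurableSpace Ω] {P : Measure Ω}
    [IsProbabilityMeasure P] {X : Ω → ℝ} {v : NNReal} (hX : HasLaw X (gaussianReal 0 v) P)
    (hv : v ≤ 1) {c : ℝ} (hc : 0 < c) : P {ω | c ≤ |X ω|} ≤ ENNReal.ofReal (1 / c ^ 2) := by
  rw [hX.measure_eq (p := fun x => c ≤ |x|) (measurableSet_le measurable_const measurable_norm)]
  have h := meas_ge_le_variance_div_sq (memLp_id_gaussianReal' (μ := 0) (v := v) 2 (by simp)) hc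
  simp only [id, integral_id_gaussianReal, sub_zero] at h
  refine h.trans (ENNReal.ofReal_le_ofReal ?_)
  have : variance id (gaussianReal 0 v) ≤ 1 := by
    rw [variance_id_gaussianReal]; exact_mod_cast hv
  gcongr

theorem S_le_one {W L : ℕ} [NeZero W] (x y : Site W L) : S W L x y ≤ 1 := by
  have hW : (1 : ℝ) ≤ (W : ℝ) ^ 2 := one_le_pow₀ (by exact_mod_cast NeZero.one_le)
  have h1 : ((W : ℝ) ^ 2)⁻¹ ≤ 1 := inv_le_one_of_one_le₀ hW
  have h2 : SB L (block W L x) (block W L y) ≤ 1 := by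
    simp only [SB, Matrix.of_apply]; split_ifs <;> norm_num
  simp only [S, Matrix.of_apply]
  exact mul_le_one₀ h2 (by positivity) h1

theorem IsBandMatrix.measure_entry_tail_le {W L : ℕ} [NeZero W] {Ω : Type*}
    [MeasurableSpace Ω] {P : Measure Ω} [IsProbabilityMeasure P]
    {H : Ω → Matrix (Site W L) (Site W L) ℂ} (hH : IsBandMatrix W L P H) {c : ℝ} (hc : 0 < c)
    (x y : Site W L) : P {ω | 2 * c < ‖H ω x y‖} ≤ ENNReal.ofReal (2 / c ^ 2) := by
  have hS := S_le_one (W := W) (L := L) x y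
  by_cases hxy : x = y
  · subst hxy
    refine (measure_mono fun ω hω => ?_).trans ((measure_gaussian_tail_le (hH.diag x)
      (by rw [← NNReal.coe_le_coe, Real.coe_toNNReal']; exact max_le hS (by simp)) hc).trans
      (ENNReal.ofReal_le_ofReal (by gcongr; norm_num)))
    simp only [Set.mem_ofPred_eq] at hω ⊢
    have h1 : H ω x x = ((H ω x x).re : ℂ) := ((hH.hermitian ω).coe_re_apply_self x).symm
    rw [h1, Complex.norm_real, Real.norm_eq_abs] at hω
    linarith
  · have hv : (S W L x y / 2).toNNReal ≤ 1 := by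
      rw [← NNReal.coe_le_coe, Real.coe_toNNReal']; exact max_le (by push_cast; linarith) (by simp)
    have h1 := measure_gaussian_tail_le (hH.offdiag_re x y hxy) hv hc
    have h2 := measure_gaussian_tail_le (hH.offdiag_im x y hxy) hv hc
    have hsub : {ω | 2 * c < ‖H ω x y‖} ⊆
        {ω | c ≤ |(H ω x y).re|} ∪ {ω | c ≤ |(H ω x y).im|} := by
      intro ω hω
      simp only [Set.mem_ofPred_eq, Set.mem_union] at hω ⊢
      by_contra! hcon
      have := Complex.norm_le_abs_re_add_abs_im (H ω x y)
      linarith [hcon.1, hcon.2]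
    refine (measure_mono hsub).trans ((measure_union_le _ _).trans ((add_le_add h1 h2).trans ?_))
    rw [← ENNReal.ofReal_add (by positivity) (by positivity)]
    exact ENNReal.ofReal_le_ofReal (le_of_eq (by ring))

/-! ### Concentration of sums of coloured families -/

section

variable {Ω : Type*} [MeasurableSpace Ω] {P : Measure Ω} [IsProbabilityMeasure P]

/-- Hoeffding's inequality: a variable in `[-A w, A w]` has sub-Gaussian variance proxy `(A w)²`.
Hypothesis `hpos` excludes a vanishing total proxy, for which the exponent would be `0 / 0`. -/
theorem measure_sum_centered_ge_le {β : Type*} [Fintype β] {X : β → Ω → ℝ}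
    (hX : ∀ b, Measurable (X b)) (hind : iIndepFun X P) {A : ℝ} (hA : 0 ≤ A) {w : β → ℝ}
    (hbd : ∀ b ω, |X b ω| ≤ A * w b) {ν : ℝ} (hν : 0 ≤ ν) (hpos : A ^ 2 * ∑ b, w b ^ 2 ≠ 0) :
    P {ω | ν * A * Real.sqrt (∑ b, w b ^ 2) ≤ ∑ b, (X b ω - ∫ ω', X b ω' ∂P)} ≤
      ENNReal.ofReal (Real.exp (-(ν ^ 2 / 2))) := by
  have hsub : ∀ b, HasSubgaussianMGF (fun ω => X b ω - ∫ ω', X b ω' ∂P)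
      ((‖A * w b - -(A * w b)‖₊ / 2) ^ 2) P := fun b =>
    hasSubgaussianMGF_of_mem_Icc (hX b).aemeasurable
      (Eventually.of_forall fun ω => abs_le.1 (hbd b ω))
  have hind' : iIndepFun (fun b ω => X b ω - ∫ ω', X b ω' ∂P) P :=
    hind.comp (fun b x => x - ∫ ω', X b ω' ∂P) fun b => measurable_id.sub_const _
  have h := HasSubgaussianMGF.measure_sum_ge_le_of_iIndepFun hind' (s := Finset.univ)
    (fun b _ => hsub b) (ε := ν * A * Real.sqrt (∑ b, w b ^ 2)) (by positivity)
  have hc : ((∑ b, (‖A * w b - -(A * w b)‖₊ / 2) ^ 2 : NNReal) : ℝ) = A ^ 2 * ∑ b, w b ^ 2 := by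
    push_cast
    rw [Finset.mul_sum]
    refine Finset.sum_congr rfl fun b _ => ?_
    rw [Real.norm_eq_abs, div_pow, sq_abs]; ring
  rw [← ofReal_measureReal]
  refine ENNReal.ofReal_le_ofReal (h.trans (le_of_eq ?_))
  congr 1
  rw [hc, mul_pow, mul_pow,
    Real.sq_sqrt (Finset.sum_nonneg fun _ _ => sq_nonneg _), mul_assoc, neg_div, neg_inj,
    mul_comm (2 : ℝ), ← div_div, mul_div_assoc, div_self hpos, mul_one]

theorem measure_norm_sum_centered_gt_le {β : Type*} [Fintype β] {X : β → Ω → ℂ}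
    (hX : ∀ b, Measurable (X b)) (hind : iIndepFun X P) {A : ℝ} (hA : 0 ≤ A)
    (hbd : ∀ b ω, ‖X b ω‖ ≤ A) (z : β → ℂ) {ν : ℝ} (hν : 0 ≤ ν) :
    P {ω | 2 * ν * A * Real.sqrt (∑ b, ‖z b‖ ^ 2) <
      ‖∑ b, z b * (X b ω - ∫ ω', X b ω' ∂P)‖} ≤
      ENNReal.ofReal (4 * Real.exp (-(ν ^ 2 / 2))) := by
  have hint : ∀ b, Integrable (X b) P := fun b =>
    Integrable.of_bound (hX b).aestronglyMeasurable A (Eventually.of_forall (hbd b))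
  -- In the degenerate case the sum vanishes identically, and the strict inequality makes the event
  -- empty.
  by_cases h0 : A ^ 2 * ∑ b, ‖z b‖ ^ 2 = 0
  · have hz : ∀ ω, ∑ b, z b * (X b ω - ∫ ω', X b ω' ∂P) = 0 := by
      intro ω
      refine Finset.sum_eq_zero fun b _ => ?_
      rcases mul_eq_zero.1 h0 with h | h
      · have hX0 : ∀ ω, X b ω = 0 := fun ω => by
          have := hbd b ω
          rw [pow_eq_zero_iff two_ne_zero] at h
          rw [h] at this
          simpa using this
        simp [hX0]
      · rw [Finset.sum_eq_zero_iff_of_nonneg fun _ _ => sq_nonneg _] at h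
        have : z b = 0 := by simpa using h b (Finset.mem_univ b)
        rw [this, zero_mul]
    have : {ω | 2 * ν * A * Real.sqrt (∑ b, ‖z b‖ ^ 2) <
      ‖∑ b, z b * (X b ω - ∫ ω', X b ω' ∂P)‖} = ∅ := by
      ext ω
      simp only [hz, norm_zero, Set.mem_ofPred_eq, Set.mem_empty_iff_false, iff_false, not_lt]
      positivity
    rw [this, measure_empty]
    exact zero_le
  set T := ν * A * Real.sqrt (∑ b, ‖z b‖ ^ 2) with hT
  have key : ∀ φ : ℂ →L[ℝ] ℝ, (∀ x, |φ x| ≤ ‖x‖) →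
      P {ω | T ≤ φ (∑ b, z b * (X b ω - ∫ ω', X b ω' ∂P))} ≤
        ENNReal.ofReal (Real.exp (-(ν ^ 2 / 2))) := by
    intro φ hφ
    have h := measure_sum_centered_ge_le (P := P) (X := fun b ω => φ (z b * X b ω))
      (fun b => φ.continuous.measurable.comp ((hX b).const_mul _))
      (hind.comp (fun b x => φ (z b * x)) fun b =>
        φ.continuous.measurable.comp (measurable_id.const_mul _)) hA (w := fun b => ‖z b‖)
      (fun b ω => (hφ _).trans (by
        rw [norm_mul, mul_comm]
        exact mul_le_mul_of_nonneg_right (hbd b ω) (norm_nonneg _))) hν h0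
    have hset : ∀ ω, φ (∑ b, z b * (X b ω - ∫ ω', X b ω' ∂P)) =
        ∑ b, (φ (z b * X b ω) - ∫ ω', φ (z b * X b ω') ∂P) := fun ω => ?_
    · simp only [hset]; exact h
    rw [map_sum]
    refine Finset.sum_congr rfl fun b _ => ?_
    rw [ContinuousLinearMap.integral_comp_comm φ ((hint b).const_mul _), integral_const_mul,
      mul_sub, map_sub]
  have k1 := key Complex.reCLM Complex.abs_re_le_norm
  have k2 := key (-Complex.reCLM) (fun x => by simpa using Complex.abs_re_le_norm x)
  have k3 := key Complex.imCLM Complex.abs_im_le_norm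
  have k4 := key (-Complex.imCLM) (fun x => by simpa using Complex.abs_im_le_norm x)
  -- A complex number of norm above `2 T` has a real or imaginary part of size at least `T`; with
  -- signs this makes four one-sided events.
  have hsub : {ω | 2 * ν * A * Real.sqrt (∑ b, ‖z b‖ ^ 2) <
      ‖∑ b, z b * (X b ω - ∫ ω', X b ω' ∂P)‖} ⊆
      ({ω | T ≤ Complex.reCLM (∑ b, z b * (X b ω - ∫ ω', X b ω' ∂P))} ∪
        {ω | T ≤ (-Complex.reCLM) (∑ b, z b * (X b ω - ∫ ω', X b ω' ∂P))}) ∪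
      ({ω | T ≤ Complex.imCLM (∑ b, z b * (X b ω - ∫ ω', X b ω' ∂P))} ∪
        {ω | T ≤ (-Complex.imCLM) (∑ b, z b * (X b ω - ∫ ω', X b ω' ∂P))}) := by
    intro ω hω
    simp only [Set.mem_ofPred_eq, Set.mem_union] at hω ⊢
    generalize ∑ b, z b * (X b ω - ∫ ω', X b ω' ∂P) = s at hω ⊢
    by_contra! hcon
    obtain ⟨⟨h1, h2⟩, h3, h4⟩ := hcon
    simp only [_root_.neg_apply, Complex.reCLM_apply, Complex.imCLM_apply] at h1 h2 h3 h4
    have h5 := Complex.norm_le_abs_re_add_abs_im s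
    have h6 : |s.re| < T := abs_lt.2 ⟨by linarith, h1⟩
    have h7 : |s.im| < T := abs_lt.2 ⟨by linarith, h3⟩
    have : 2 * ν * A * Real.sqrt (∑ b, ‖z b‖ ^ 2) = 2 * T := by rw [hT]; ring
    linarith
  refine (measure_mono hsub).trans ((measure_union_le _ _).trans
    ((add_le_add (measure_union_le _ _) (measure_union_le _ _)).trans
      ((add_le_add (add_le_add k1 k2) (add_le_add k3 k4)).trans (le_of_eq ?_))))
  rw [← ENNReal.ofReal_add (by positivity) (by positivity),
    ← ENNReal.ofReal_add (by positivity) (by positivity)]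
  congr 1; ring

/-- Concentration for a family of bounded random variables that splits into `#κ` classes of
independent random variables. -/
theorem measure_norm_sum_centered_gt_le_of_colouring {β κ : Type*} [Fintype β] [Fintype κ]
    [DecidableEq κ] (col : β → κ) {X : β → Ω → ℂ} (hX : ∀ b, Measurable (X b))
    (hind : ∀ k, iIndepFun (fun b : {b // col b = k} => X b) P) {A : ℝ} (hA : 0 ≤ A)
    (hbd : ∀ b ω, ‖X b ω‖ ≤ A) (z : β → ℂ) {ν : ℝ} (hν : 0 ≤ ν) :
    P {ω | 2 * ν * A * (Real.sqrt (Fintype.card κ) * Real.sqrt (∑ b, ‖z b‖ ^ 2)) <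
      ‖∑ b, z b * (X b ω - ∫ ω', X b ω' ∂P)‖} ≤
      ENNReal.ofReal (Fintype.card κ * (4 * Real.exp (-(ν ^ 2 / 2)))) := by
  have hk := fun k => measure_norm_sum_centered_gt_le (P := P)
    (X := fun b : {b // col b = k} => X b) (fun b => hX b) (hind k) hA (fun b => hbd b)
    (fun b => z b) hν
  have hsum : ∀ {M : Type} [AddCommMonoid M] (f : β → M),
      ∑ k, ∑ b : {b // col b = k}, f b = ∑ b, f b := fun f =>
    Fintype.sum_fiberwise col f
  -- Distinct classes may be dependent, so their bounds are added; Cauchy-Schwarz limits the loss to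
  -- the square root of the number of classes.
  have hCS : ∑ k, Real.sqrt (∑ b : {b // col b = k}, ‖z b‖ ^ 2) ≤
      Real.sqrt (Fintype.card κ) * Real.sqrt (∑ b, ‖z b‖ ^ 2) := by
    rw [← Real.sqrt_mul (by positivity)]
    apply Real.le_sqrt_of_sq_le
    have h1 := sq_sum_le_card_mul_sum_sq (s := (Finset.univ : Finset κ))
      (f := fun k => Real.sqrt (∑ b : {b // col b = k}, ‖z b‖ ^ 2))
    refine h1.trans (le_of_eq ?_)
    rw [Finset.card_univ, ← hsum]
    congr 1
    exact Finset.sum_congr rfl fun k _ => Real.sq_sqrt (Finset.sum_nonneg fun _ _ => sq_nonneg _)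
  have hsub : {ω | 2 * ν * A * (Real.sqrt (Fintype.card κ) * Real.sqrt (∑ b, ‖z b‖ ^ 2)) <
      ‖∑ b, z b * (X b ω - ∫ ω', X b ω' ∂P)‖} ⊆
      ⋃ k, {ω | 2 * ν * A * Real.sqrt (∑ b : {b // col b = k}, ‖z b‖ ^ 2) <
        ‖∑ b : {b // col b = k}, z b * (X b ω - ∫ ω', X b ω' ∂P)‖} := by
    intro ω hω
    simp only [Set.mem_ofPred_eq, Set.mem_iUnion] at hω ⊢
    by_contra! hcon
    have h1 : ‖∑ b, z b * (X b ω - ∫ ω', X b ω' ∂P)‖ ≤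
        2 * ν * A * ∑ k, Real.sqrt (∑ b : {b // col b = k}, ‖z b‖ ^ 2) := by
      rw [← hsum, Finset.mul_sum]
      exact (norm_sum_le _ _).trans (Finset.sum_le_sum fun k _ => hcon k)
    have h2 : 2 * ν * A * ∑ k, Real.sqrt (∑ b : {b // col b = k}, ‖z b‖ ^ 2) ≤
        2 * ν * A * (Real.sqrt (Fintype.card κ) * Real.sqrt (∑ b, ‖z b‖ ^ 2)) := by gcongr
    linarith
  refine (measure_mono hsub).trans ((measure_iUnion_fintype_le _ _).trans
    ((Finset.sum_le_sum fun k _ => hk k).trans (le_of_eq ?_)))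
  rw [Finset.sum_const, Finset.card_univ, nsmul_eq_mul,
    ENNReal.ofReal_mul (p := (Fintype.card κ : ℝ)) (by positivity), ENNReal.ofReal_natCast]

/-- Concentration for a family `Y` that is close, with high probability, to a family `Y'` that splits
into `#κ` classes of independent random variables. -/
theorem measure_norm_sum_centered_gt_le_of_approx {α β κ : Type*} [Fintype α] [Fintype β]
    [Fintype κ] [DecidableEq κ] (col : β → κ) {Y Y' : β → Ω → ℂ} (hY : ∀ b, Measurable (Y b))
    (hY' : ∀ b, Measurable (Y' b))
    (hind : ∀ k, iIndepFun (fun b : {b // col b = k} => Y' b) P) {B : ℝ}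
    (hYB : ∀ b ω, ‖Y b ω‖ ≤ B) (hYB' : ∀ b ω, ‖Y' b ω‖ ≤ B) {A e η : ℝ} (hA : 0 ≤ A)
    (he : 0 ≤ e) (hη : 0 ≤ η) (hB : 0 ≤ B)
    (hbad : P {ω | ∃ b, e < ‖Y b ω - Y' b ω‖ ∨ A < ‖Y b ω‖} ≤ ENNReal.ofReal η)
    (z : α → β → ℂ) {ν : ℝ} (hν : 0 ≤ ν) :
    P (⋃ a, {ω | 2 * ν * (A + e) * (Real.sqrt (Fintype.card κ) * Real.sqrt (∑ b, ‖z a b‖ ^ 2)) +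
      (∑ b, ‖z a b‖) * (2 * e + 2 * B * η) < ‖∑ b, z a b * (Y b ω - ∫ ω', Y b ω' ∂P)‖}) ≤
      ENNReal.ofReal (η + Fintype.card α * (Fintype.card κ * (4 * Real.exp (-(ν ^ 2 / 2))))) := by
  -- Off the bad event `Y'` is bounded by `A + e`, but Hoeffding needs this bound everywhere.
  -- Truncating each variable separately preserves independence and changes nothing off the bad
  -- event.
  set tr : ℂ → ℂ := fun x => if ‖x‖ ≤ A + e then x else 0 with htr
  have htrm : Measurable tr :=
    Measurable.ite (measurableSet_le measurable_norm measurable_const) measurable_id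
      measurable_const
  have htr1 : ∀ x, ‖tr x‖ ≤ A + e := fun x => by
    simp only [htr]; split_ifs with h
    · exact h
    · rw [norm_zero]; positivity
  have htr2 : ∀ x, ‖tr x‖ ≤ ‖x‖ := fun x => by
    simp only [htr]; split_ifs with h
    · exact le_rfl
    · rw [norm_zero]; positivity
  set X : β → Ω → ℂ := fun b ω => tr (Y' b ω) with hX
  have hXm : ∀ b, Measurable (X b) := fun b => htrm.comp (hY' b)
  set bad : Set Ω := {ω | ∃ b, e < ‖Y b ω - Y' b ω‖ ∨ A < ‖Y b ω‖} with hbaddef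
  have hgood : ∀ ω, ω ∉ bad → ∀ b, ‖Y b ω - X b ω‖ ≤ e := by
    intro ω hω b
    simp only [hbaddef, Set.mem_ofPred_eq, not_exists, not_or, not_lt] at hω
    obtain ⟨h1, h2⟩ := hω b
    have h3 : ‖Y' b ω‖ ≤ A + e := by
      have : Y' b ω = Y b ω - (Y b ω - Y' b ω) := by ring
      rw [this]
      exact (norm_sub_le _ _).trans (add_le_add h2 h1)
    simp only [hX, htr, if_pos h3]
    exact h1
  have hYi : ∀ b, Integrable (Y b) P := fun b =>
    Integrable.of_bound (hY b).aestronglyMeasurable B (Eventually.of_forall (hYB b))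
  have hXi : ∀ b, Integrable (X b) P := fun b =>
    Integrable.of_bound (hXm b).aestronglyMeasurable B
      (Eventually.of_forall fun ω => (htr2 _).trans (hYB' b ω))
  -- The centrings differ by `e` from the good event, plus the crude bound `2 B` times the
  -- probability of the rest.
  have hE : ∀ b, ‖∫ ω, Y b ω ∂P - ∫ ω, X b ω ∂P‖ ≤ e + 2 * B * η := by
    intro b
    rw [← integral_sub (hYi b) (hXi b)]
    set S : Set Ω := {ω | e < ‖Y b ω - X b ω‖} with hS
    have hSm : MeasurableSet S :=
      measurableSet_lt measurable_const ((hY b).sub (hXm b)).norm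
    have hSP : P.real S ≤ η := by
      refine ENNReal.toReal_le_of_le_ofReal hη ((measure_mono fun ω hω => ?_).trans hbad)
      by_contra hcon
      exact absurd (hgood ω hcon b) (not_le.2 hω)
    have hle : ∀ ω, ‖Y b ω - X b ω‖ ≤ e + S.indicator (fun _ => 2 * B) ω := by
      intro ω
      by_cases hω : ω ∈ S
      · rw [Set.indicator_of_mem hω]
        have := (norm_sub_le (Y b ω) (X b ω)).trans
          (add_le_add (hYB b ω) ((htr2 _).trans (hYB' b ω)))
        linarith
      · rw [Set.indicator_of_notMem hω, add_zero]
        exact not_lt.1 hω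
    calc ‖∫ ω, (Y b ω - X b ω) ∂P‖ ≤ ∫ ω, (e + S.indicator (fun _ => 2 * B) ω) ∂P :=
          norm_integral_le_of_norm_le ((integrable_const _).add
            ((integrable_const _).indicator hSm)) (Eventually.of_forall hle)
      _ = e + P.real S * (2 * B) := by
          rw [integral_add (integrable_const _) ((integrable_const _).indicator hSm),
            integral_indicator hSm, integral_const, setIntegral_const]
          simp
      _ ≤ e + η * (2 * B) := by gcongr
      _ = _ := by ring
  have hconc := fun a => measure_norm_sum_centered_gt_le_of_colouring (P := P) col hXm
    (fun k => (hind k).comp (fun _ => tr) fun _ => htrm) (add_nonneg hA he)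
    (fun b ω => htr1 _) (z a) hν
  have hsub : (⋃ a, {ω | 2 * ν * (A + e) *
      (Real.sqrt (Fintype.card κ) * Real.sqrt (∑ b, ‖z a b‖ ^ 2)) +
      (∑ b, ‖z a b‖) * (2 * e + 2 * B * η) < ‖∑ b, z a b * (Y b ω - ∫ ω', Y b ω' ∂P)‖}) ⊆
      bad ∪ ⋃ a, {ω | 2 * ν * (A + e) *
        (Real.sqrt (Fintype.card κ) * Real.sqrt (∑ b, ‖z a b‖ ^ 2)) <
        ‖∑ b, z a b * (X b ω - ∫ ω', X b ω' ∂P)‖} := by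
    intro ω hω
    rw [Set.mem_union]
    by_cases hb : ω ∈ bad
    · exact .inl hb
    right
    obtain ⟨a, ha⟩ := Set.mem_iUnion.1 hω
    refine Set.mem_iUnion.2 ⟨a, ?_⟩
    rw [Set.mem_ofPred_eq] at ha ⊢
    have h1 : ∑ b, z a b * (Y b ω - ∫ ω', Y b ω' ∂P) = ∑ b, z a b * (X b ω - ∫ ω', X b ω' ∂P) +
        ∑ b, z a b * ((Y b ω - X b ω) - (∫ ω', Y b ω' ∂P - ∫ ω', X b ω' ∂P)) := by
      rw [← Finset.sum_add_distrib]
      exact Finset.sum_congr rfl fun _ _ => by ring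
    have h2 : ‖∑ b, z a b * ((Y b ω - X b ω) - (∫ ω', Y b ω' ∂P - ∫ ω', X b ω' ∂P))‖ ≤
        (∑ b, ‖z a b‖) * (2 * e + 2 * B * η) := by
      rw [Finset.sum_mul]
      refine (norm_sum_le _ _).trans (Finset.sum_le_sum fun b _ => ?_)
      rw [norm_mul]
      refine mul_le_mul_of_nonneg_left ((norm_sub_le _ _).trans ?_) (norm_nonneg _)
      have := hgood ω hb b
      have := hE b
      linarith
    have h3 := norm_add_le (∑ b, z a b * (X b ω - ∫ ω', X b ω' ∂P))
      (∑ b, z a b * ((Y b ω - X b ω) - (∫ ω', Y b ω' ∂P - ∫ ω', X b ω' ∂P)))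
    rw [← h1] at h3
    linarith
  refine (measure_mono hsub).trans ((measure_union_le _ _).trans ((add_le_add hbad
    ((measure_iUnion_fintype_le _ _).trans (Finset.sum_le_sum fun a _ => hconc a))).trans
      (le_of_eq ?_)))
  rw [Finset.sum_const, Finset.card_univ, nsmul_eq_mul, ENNReal.ofReal_add hη (by positivity),
    ENNReal.ofReal_mul (p := (Fintype.card α : ℝ)) (by positivity), ENNReal.ofReal_natCast]

end

/-! ### Fluctuations of the sums of the localized polynomials -/

theorem card_site (W L : ℕ) [NeZero W] [NeZero L] :
    (Fintype.card (Site W L) : ℝ) = size W L := by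
  rw [Fintype.card_prod, ZMod.card, size]; push_cast; ring

/-- Bound, at a fixed size of the model, of the fluctuations of `∑_b Z_{ab} Y_b`. -/
theorem measure_fluctSum_gt_le {W L : ℕ} [NeZero W] [NeZero L] {Ω : Type*} [MeasurableSpace Ω]
    {P : Measure Ω} [IsProbabilityMeasure P] {H : Ω → Matrix (Site W L) (Site W L) ℂ}
    (hH : IsBandMatrix W L P H) {E t : ℝ} (ht1 : t ≤ 1) {u : ℕ} {σ : Fin u → Bool}
    {coef : Blk L → (Fin u → Site W L) → (Fin u → Site W L) → ℂ} {B g h q R : ℝ}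
    (hη : 0 < eta E t) (hg1 : 1 ≤ g) (hg : (eta E t)⁻¹ ≤ g) (hB : 0 ≤ B) (hh : 0 ≤ h)
    (hq : 0 ≤ q) (hR : 1 ≤ R) (hcoef : ∀ b x y, ‖coef b x y‖ ≤ B)
    (hloc : ∀ b x y, (∃ i, R ≤ (perNorm (block W L (x i) - b) : ℝ) +
      (perNorm (block W L (y i) - b) : ℝ)) → coef b x y = 0)
    {A p₁ p₂ p₃ : ℝ} (hA : 0 ≤ A) (hp₁ : 0 ≤ p₁) (hp₂ : 0 ≤ p₂) (hp₃ : 0 ≤ p₃)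
    (h₁ : P {ω | ∃ x y, R ≤ (perNorm (block W L x - block W L y) : ℝ) ∧
      q < ‖G W L E t (H ω) true x y‖} ≤ ENNReal.ofReal p₁)
    (h₂ : P {ω | ∃ x y, h < ‖H ω x y‖} ≤ ENNReal.ofReal p₂)
    (h₃ : P {ω | ∃ b, A < ‖Ypoly W L E t σ coef (H ω) b‖} ≤ ENNReal.ofReal p₃)
    (Z : Matrix (Blk L) (Blk L) ℂ) {ν : ℝ} (hν : 0 ≤ ν) {e B' : ℝ}
    (he : e = (size W L ^ u) ^ 2 * (B * (u * (g ^ u * (size W L ^ 2 * (g * h * q))))))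
    (hB' : B' = (size W L ^ u) ^ 2 * (B * g ^ u)) :
    P (⋃ a, {ω | 2 * ν * (A + e) * (10 * R * Real.sqrt (∑ b, ‖Z a b‖ ^ 2)) +
      (∑ b, ‖Z a b‖) * (2 * e + 2 * B' * (p₁ + p₂ + p₃)) <
        ‖fluctSum P Z (fun ω' b => Ypoly W L E t σ coef (H ω') b) a ω‖}) ≤
      ENNReal.ofReal (p₁ + p₂ + p₃ + (L : ℝ) ^ 2 * (100 * R ^ 2 * (4 * Real.exp (-(ν ^ 2 / 2))))) := by
  classical
  -- Centres at distance at least `4R` have disjoint balls of radius `2R`. As `R ≥ 1`, `K ≤ 5R`, so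
  -- there are `(2K)² ≤ 100 R²` colours.
  set K : ℕ := ⌈4 * R⌉₊ with hK
  have hK0 : 0 < K := Nat.ceil_pos.2 (by linarith)
  have : NeZero K := ⟨hK0.ne'⟩
  have hK1 : 4 * R ≤ K := Nat.le_ceil _
  have hK2 : (K : ℝ) ≤ 5 * R := by
    have := Nat.ceil_lt_add_one (a := 4 * R) (by linarith)
    linarith
  have hN0 : 0 ≤ size W L := by unfold size; positivity
  have he0 : 0 ≤ e := by rw [he]; positivity
  have hB0 : 0 ≤ B' := by rw [hB']; positivity
  have hcard : (Fintype.card (Fin u → Site W L) : ℝ) = size W L ^ u := by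
    rw [Fintype.card_fun, Fintype.card_fin, Nat.cast_pow, card_site]
  let p : Blk L → Site W L → Prop := fun b x => (perNorm (block W L x - b) : ℝ) < 2 * R
  have hcutm : ∀ (b : Blk L) x y, Measurable fun ω => cut (p b) (H ω) x y := by
    intro b x y
    simp only [cut, Matrix.of_apply]
    split_ifs
    · exact hH.measurable x y
    · exact measurable_const
  have hmain := measure_norm_sum_centered_gt_le_of_approx (P := P) (α := Blk L)
    (torusColour L K) (Y := fun b ω => Ypoly W L E t σ coef (H ω) b)
    (Y' := fun b ω => Ypoly W L E t σ coef (cut (p b) (H ω)) b)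
    (fun b => measurable_Ypoly E t σ coef hH.measurable b)
    (fun b => measurable_Ypoly E t σ coef (hcutm b) b)
    (fun k => hH.iIndepFun_comp_cut (β := {b // torusColour L K b = k}) (fun b => p b)
      (fun b b' x hb hb' => by
        by_contra hne
        have h1 := le_perNorm_of_torusColour_eq (b.2.trans b'.2.symm)
          (fun h => hne (Subtype.ext h))
        have h2 := perNorm_sub_le b.1 (block W L x) b'.1
        rw [perNorm_sub_comm b.1 (block W L x)] at h2
        have h3 : (K : ℝ) ≤ perNorm (block W L x - b.1) + perNorm (block W L x - b'.1) := by
          exact_mod_cast h1.trans h2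
        have h4 : (perNorm (block W L x - b.1) : ℝ) < 2 * R := hb
        have h5 : (perNorm (block W L x - b'.1) : ℝ) < 2 * R := hb'
        linarith)
      (fun b M => Ypoly W L E t σ coef M b)
      fun b Ω' _ M hM => measurable_Ypoly E t σ coef hM b)
    (B := B')
    (fun b ω => by rw [hB', ← hcard]; exact norm_Ypoly_le hη hg hcoef (hH.hermitian ω) b)
    (fun b ω => by
      rw [hB', ← hcard]
      exact norm_Ypoly_le hη hg hcoef (cut_isHermitian (p b) (hH.hermitian ω)) b)
    hA he0 (η := p₁ + p₂ + p₃) (by positivity) hB0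
    (by
      have hsub : {ω | ∃ b, e < ‖Ypoly W L E t σ coef (H ω) b -
            Ypoly W L E t σ coef (cut (p b) (H ω)) b‖ ∨ A < ‖Ypoly W L E t σ coef (H ω) b‖} ⊆
          ({ω | ∃ x y, R ≤ (perNorm (block W L x - block W L y) : ℝ) ∧
            q < ‖G W L E t (H ω) true x y‖} ∪ {ω | ∃ x y, h < ‖H ω x y‖}) ∪
          {ω | ∃ b, A < ‖Ypoly W L E t σ coef (H ω) b‖} := by
        intro ω hω
        by_contra hcon
        simp only [Set.mem_union, not_or, Set.mem_ofPred_eq, not_exists, not_and, not_lt] at hcon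
        obtain ⟨⟨c1, c2⟩, c3⟩ := hcon
        obtain ⟨b, hb | hb⟩ := hω
        · have := norm_Ypoly_sub_Ypoly_cut_le ht1 (σ := σ) hη hg1 hg hB hcoef hloc
            (hH.hermitian ω) c2 hq c1 b (p b) fun x => Iff.rfl
          rw [hcard, card_site, ← he] at this
          exact absurd this (not_le.2 hb)
        · exact absurd (c3 b) (not_le.2 hb)
      refine (measure_mono hsub).trans ((measure_union_le _ _).trans ((add_le_add
        (measure_union_le _ _) le_rfl).trans ?_))
      rw [ENNReal.ofReal_add (by positivity) hp₃, ENNReal.ofReal_add hp₁ hp₂]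
      exact add_le_add (add_le_add h₁ h₂) h₃)
    (fun a b => Z a b) hν
  have hcol : (Fintype.card (Fin (2 * K) × Fin (2 * K)) : ℝ) = (2 * K) ^ 2 := by
    rw [Fintype.card_prod, Fintype.card_fin]; push_cast; ring
  have hblk : (Fintype.card (Blk L) : ℝ) = (L : ℝ) ^ 2 := by
    rw [Fintype.card_prod, ZMod.card]; push_cast; ring
  rw [hcol, hblk, Real.sqrt_sq (by positivity)] at hmain
  refine (measure_mono (Set.iUnion_mono fun a ω hω => ?_)).trans
    (hmain.trans (ENNReal.ofReal_le_ofReal ?_))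
  · rw [Set.mem_ofPred_eq] at hω ⊢
    refine lt_of_le_of_lt (add_le_add_left ?_ _) hω
    refine mul_le_mul_of_nonneg_left ?_ (by positivity)
    exact mul_le_mul_of_nonneg_right (by linarith) (Real.sqrt_nonneg _)
  · have : (2 * (K : ℝ)) ^ 2 ≤ 100 * R ^ 2 := by nlinarith [(Nat.cast_nonneg K : (0 : ℝ) ≤ K)]
    gcongr

/-! ### Sizes and scales -/

theorem one_le_cast_of_neZero (k : ℕ) [NeZero k] : (1 : ℝ) ≤ k := by
  exact_mod_cast NeZero.one_le

theorem one_le_size {W L : ℕ} [NeZero W] [NeZero L] : 1 ≤ size W L :=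
  one_le_mul_of_one_le_of_one_le (one_le_pow₀ (one_le_cast_of_neZero W))
    (one_le_pow₀ (one_le_cast_of_neZero L))

theorem sq_width_le_size {W L : ℕ} [NeZero L] : (W : ℝ) ^ 2 ≤ size W L :=
  le_mul_of_one_le_right (by positivity) (one_le_pow₀ (one_le_cast_of_neZero L))

theorem sq_length_le_size {W L : ℕ} [NeZero W] : (L : ℝ) ^ 2 ≤ size W L :=
  le_mul_of_one_le_left (by positivity) (one_le_pow₀ (one_le_cast_of_neZero W))

theorem width_le_size {W L : ℕ} [NeZero W] [NeZero L] : (W : ℝ) ≤ size W L :=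
  (le_self_pow₀ (one_le_cast_of_neZero W) two_ne_zero).trans sq_width_le_size

theorem length_le_size {W L : ℕ} [NeZero W] [NeZero L] : (L : ℝ) ≤ size W L :=
  (le_self_pow₀ (one_le_cast_of_neZero L) two_ne_zero).trans sq_length_le_size

theorem one_le_ell {L : ℕ} [NeZero L] {t : ℝ} (h0 : 0 ≤ t) (h1 : t < 1) : 1 ≤ ell L t := by
  refine le_min ?_ (one_le_cast_of_neZero L)
  rw [abs_of_pos (by linarith)]
  exact Real.one_le_rpow_of_pos_of_le_one_of_nonpos (by linarith) (by linarith) (by norm_num)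

theorem ell_le {L : ℕ} (t : ℝ) : ell L t ≤ L := min_le_right _ _

/-- At distance at least `X ℓ_s`, the primitive loop and the control of the two-loop are
exponentially small in `√X`. -/
theorem exp_decay_of_mul_ell_le {L : ℕ} [NeZero L] {s X d : ℝ} (h0 : 0 ≤ s) (h1 : s < 1)
    (hX : 1 < X) (hd : X * ell L s ≤ d) (hdL : d ≤ L) :
    Real.exp (-(Real.sqrt d / Real.sqrt (ell L s))) ≤ Real.exp (-(Real.sqrt X / 2)) ∧
      Real.exp (-(Real.sqrt (1 - s) / 2 * d)) ≤ Real.exp (-(Real.sqrt X / 2)) := by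
  have hℓ := one_le_ell (L := L) h0 h1
  have hX0 : 0 ≤ Real.sqrt X := Real.sqrt_nonneg _
  constructor <;> apply Real.exp_le_exp.2 <;> apply neg_le_neg
  · have h2 : Real.sqrt X ≤ Real.sqrt d / Real.sqrt (ell L s) := by
      rw [← Real.sqrt_div' _ (by linarith)]
      apply Real.sqrt_le_sqrt
      rwa [le_div_iff₀ (by linarith)]
    linarith
  -- If the minimum were `L`, then `d ≥ X L > L`, beyond the diameter of the torus.
  · have h2 : ell L s = (1 - s) ^ (-(1 / 2) : ℝ) := by
      unfold ell
      rw [abs_of_pos (by linarith)]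
      refine min_eq_left ?_
      by_contra! hlt
      have : ell L s = L := by
        unfold ell
        rw [abs_of_pos (by linarith)]
        exact min_eq_right hlt.le
      rw [this] at hd
      nlinarith [one_le_cast_of_neZero L]
    have h3 : Real.sqrt (1 - s) * ell L s = 1 := by
      rw [h2, Real.sqrt_eq_rpow, ← Real.rpow_add (by linarith)]
      norm_num
    have h4 : X ≤ Real.sqrt (1 - s) * d := by
      calc X = Real.sqrt (1 - s) * (X * ell L s) := by linear_combination -X * h3
        _ ≤ _ := by gcongr
    have h5 : Real.sqrt X ≤ X := by
      rw [Real.sqrt_le_left (by linarith)]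
      nlinarith
    linarith

theorem eventually_exp_neg_mul_rpow_le {a γ : ℝ} (ha : 0 < a) (hγ : 0 < γ) (k : ℝ) :
    ∀ᶠ x : ℝ in atTop, Real.exp (-(a * x ^ γ)) ≤ x ^ (-k) := by
  have h := (isLittleO_exp_neg_mul_rpow_atTop ha (-k / γ)).bound (c := 1) one_pos
  have h2 := (tendsto_rpow_atTop hγ).eventually h
  filter_upwards [h2, eventually_gt_atTop 0] with x hx hx0
  rw [one_mul, Real.norm_of_nonneg (Real.exp_pos _).le, Real.norm_of_nonneg (by positivity),
    ← Real.rpow_mul hx0.le, mul_div_cancel₀ _ hγ.ne', neg_mul] at hx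
  exact hx

theorem eventually_le_rpow (c : ℝ) {γ : ℝ} (hγ : 0 < γ) : ∀ᶠ x : ℝ in atTop, c ≤ x ^ γ :=
  (tendsto_rpow_atTop hγ).eventually_ge_atTop c

theorem eventually_log_le_rpow {γ : ℝ} (hγ : 0 < γ) :
    ∀ᶠ x : ℝ in atTop, 2 * (1 + Real.log x) ≤ x ^ γ := by
  have h := (isLittleO_log_rpow_atTop hγ).bound (c := 1 / 4) (by norm_num)
  filter_upwards [h, eventually_le_rpow 4 hγ, eventually_ge_atTop 1] with x hx h4 h1
  rw [Real.norm_of_nonneg (Real.log_nonneg h1), Real.norm_of_nonneg (by positivity)] at hx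
  linarith

/-! ### Decay of the resolvent -/

section Family

variable {W L : ℕ → ℕ} [∀ n, NeZero (W n)] [∀ n, NeZero (L n)]

/-- In the bulk `Im m` is bounded below, so `η_s` is at least a constant times `N⁻¹`; the constant
is absorbed into one more power of `N`. -/
theorem eventually_inv_eta_le (hN : Tendsto (fun n => size (W n) (L n)) atTop atTop)
    {κ : ℝ} (hκ : 0 < κ) {E : ℕ → ℝ} (hE : ∀ n, |E n| ≤ 2 - κ) {s : ℕ → ℝ}
    (hs : ∀ n, (size (W n) (L n))⁻¹ ≤ 1 - s n) :
    ∀ᶠ n in atTop, 0 < eta (E n) (s n) ∧ (eta (E n) (s n))⁻¹ ≤ size (W n) (L n) ^ 2 := by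
  have hκ2 : κ ≤ 2 := by linarith [(abs_nonneg _).trans (hE 0)]
  set c := Real.sqrt (κ * (4 - κ)) / 2 with hc
  have hc0 : 0 < c := by
    have : 0 < κ * (4 - κ) := mul_pos hκ (by linarith)
    positivity
  filter_upwards [hN.eventually_ge_atTop c⁻¹] with n hn
  have hN1 : 1 ≤ size (W n) (L n) := one_le_size
  set N := size (W n) (L n)
  have h1 : c ≤ Real.sqrt (4 - E n ^ 2) / 2 := by
    rw [hc]
    gcongr
    have := abs_le.1 (hE n)
    nlinarith
  have h2 : N⁻¹ ≤ c := inv_le_of_inv_le₀ hc0 hn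
  have h3 : (N ^ 2)⁻¹ ≤ eta (E n) (s n) := by
    rw [eta_eq, sq, mul_inv]
    exact mul_le_mul (hs n) (h2.trans h1) (by positivity) (le_trans (by positivity) (hs n))
  have h4 : 0 < (N ^ 2)⁻¹ := by positivity
  exact ⟨h4.trans_le h3, inv_le_of_inv_le₀ (by positivity) h3⟩

theorem eventually_exp_neg_sqrt_width_le
    (hN : Tendsto (fun n => size (W n) (L n)) atTop atTop) {c : ℝ} (hc : 0 < c)
    (hW : ∀ n, size (W n) (L n) ^ c ≤ (W n : ℝ)) {τ : ℝ} (hτ : 0 < τ) (k : ℝ) :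
    ∀ᶠ n in atTop, 1 < (W n : ℝ) ^ τ ∧
      Real.exp (-(Real.sqrt ((W n : ℝ) ^ τ) / 2)) ≤ size (W n) (L n) ^ (-k) := by
  have hγ : 0 < c * τ / 2 := by positivity
  filter_upwards [hN.eventually (eventually_exp_neg_mul_rpow_le (a := 1 / 2) (by norm_num) hγ k),
    hN.eventually (eventually_le_rpow 2 (mul_pos hc hτ))] with n hn hn2
  have hN1 : 1 ≤ size (W n) (L n) := one_le_size
  set N := size (W n) (L n)
  have h1 : N ^ (c * τ) ≤ (W n : ℝ) ^ τ := by
    rw [Real.rpow_mul (by linarith)]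
    exact Real.rpow_le_rpow (by positivity) (hW n) hτ.le
  refine ⟨by linarith, le_trans (Real.exp_le_exp.2 ?_) hn⟩
  have h2 : N ^ (c * τ / 2) ≤ Real.sqrt ((W n : ℝ) ^ τ) := by
    apply Real.le_sqrt_of_sq_le
    rw [← Real.rpow_natCast, ← Real.rpow_mul (by linarith)]
    refine le_trans (le_of_eq ?_) h1
    congr 1; push_cast; ring
  linarith

variable {Ω : ℕ → Type*} [∀ n, MeasurableSpace (Ω n)] {P : ∀ n, Measure (Ω n)}
  {H : ∀ n, Ω n → Matrix (Site (W n) (L n)) (Site (W n) (L n)) ℂ}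

/-- Off-diagonal decay of the resolvent beyond the scale `ℓ_s`. -/
theorem LoopDecay.eventually_measure_G_gt_le
    {E r s : ℕ → ℝ} (hdecay : LoopDecay W L P H E r s)
    (hN : Tendsto (fun n => size (W n) (L n)) atTop atTop) {c : ℝ} (hc : 0 < c)
    (hW : ∀ n, size (W n) (L n) ^ c ≤ (W n : ℝ)) (hH : ∀ n ω, (H n ω).IsHermitian)
    {κ : ℝ} (hκ : 0 < κ) (hE : ∀ n, |E n| ≤ 2 - κ) (hr : ∀ n, 0 ≤ r n) (hrs : ∀ n, r n ≤ s n)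
    (hs : ∀ n, (size (W n) (L n))⁻¹ ≤ 1 - s n) {τ : ℝ} (hτ : 0 < τ) {D₁ D : ℝ} (hD₁ : 0 < D₁)
    (hD : 0 < D) :
    ∀ᶠ n in atTop, P n {ω | ∃ x y, (W n : ℝ) ^ τ * ell (L n) (s n) ≤
        (perNorm (block (W n) (L n) x - block (W n) (L n) y) : ℝ) ∧
      size (W n) (L n) ^ (-D₁) < ‖G (W n) (L n) (E n) (s n) (H n ω) true x y‖} ≤
      ENNReal.ofReal (size (W n) (L n) ^ (-D)) := by
  -- The loop decay is used with this exponent because `W ≥ N^c` turns `W^{-(2 D₁ + 4)/c}` into at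
  -- most `N^{-(2 D₁ + 4)}`.
  have hD₀ : 0 < (2 * D₁ + 4) / c := by positivity
  filter_upwards [hdecay _ hD₀ 1 one_pos D hD, eventually_inv_eta_le hN hκ hE hs,
    eventually_exp_neg_sqrt_width_le hN hc hW hτ (2 * D₁ + 12),
    hN.eventually_ge_atTop 10] with n hn hη hexp hN10
  obtain ⟨hη0, hη⟩ := hη
  obtain ⟨hX, hexp⟩ := hexp
  refine (measure_mono fun ω hω => ?_).trans hn
  obtain ⟨x, y, hd, hG⟩ := hω
  refine Set.mem_iUnion.2 ⟨(block (W n) (L n) y, block (W n) (L n) x), ?_⟩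
  by_contra hcon
  rw [Set.mem_ofPred_eq, not_lt] at hcon
  dsimp only at hcon
  have hWN := sq_width_le_size (W := W n) (L := L n)
  have hWn := hW n
  have hsn := hs n
  have hrn := hr n
  have hrsn := hrs n
  have hEn : |E n| ≤ 2 := (hE n).trans (by linarith)
  have hGn := norm_G_sq_le_loop (E n) (s n) (hH n ω) x y
  have hs1 : s n < 1 := by
    have : 0 < (size (W n) (L n))⁻¹ := by positivity
    linarith
  have hW1 := one_le_cast_of_neZero (W n)
  have hprim := abs_primLoop_le (W := W n) (L := L n) NeZero.one_le hEn (hrn.trans hrsn) hs1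
    (block (W n) (L n) y) (block (W n) (L n) x)
  rw [perNorm_sub_comm] at hcon hprim
  obtain ⟨he1, he2⟩ := exp_decay_of_mul_ell_le (hrn.trans hrsn) hs1 hX hd
    (by exact_mod_cast perNorm_le _)
  have hℓ := one_le_ell (L := L n) (hrn.trans hrsn) hs1
  have hM : (Mt (W n) (L n) (E n) (s n) ^ 2)⁻¹ ≤ size (W n) (L n) ^ 4 := by
    have h1 : eta (E n) (s n) ≤ Mt (W n) (L n) (E n) (s n) := by
      unfold Mt
      exact le_mul_of_one_le_left hη0.le
        (one_le_mul_of_one_le_of_one_le (one_le_pow₀ hW1) (one_le_pow₀ hℓ))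
    calc (Mt (W n) (L n) (E n) (s n) ^ 2)⁻¹ ≤ (eta (E n) (s n) ^ 2)⁻¹ := by gcongr
      _ = ((eta (E n) (s n))⁻¹) ^ 2 := by rw [inv_pow]
      _ ≤ (size (W n) (L n) ^ 2) ^ 2 := by gcongr
      _ = _ := by ring
  have hratio : eta (E n) (r n) / eta (E n) (s n) ≤ size (W n) (L n) := by
    rw [eta_eq] at hη0
    have h0 : 0 < Real.sqrt (4 - E n ^ 2) / 2 := by
      by_contra! h0
      nlinarith [mul_nonneg (sub_nonneg.2 hs1.le) (neg_nonneg.2 h0)]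
    rw [eta_eq, eta_eq, mul_div_mul_right _ _ h0.ne', div_le_iff₀ (by linarith)]
    have h2 : size (W n) (L n) * (size (W n) (L n))⁻¹ = 1 := mul_inv_cancel₀ (by positivity)
    nlinarith
  have hratio0 : 0 ≤ eta (E n) (r n) / eta (E n) (s n) := by
    refine div_nonneg ?_ hη0.le
    rw [eta_eq]
    exact mul_nonneg (by linarith) (by positivity)
  have hWD : (W n : ℝ) ^ (-((2 * D₁ + 4) / c)) ≤ size (W n) (L n) ^ (-(2 * D₁ + 4)) := by
    calc (W n : ℝ) ^ (-((2 * D₁ + 4) / c))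
        ≤ (size (W n) (L n) ^ c) ^ (-((2 * D₁ + 4) / c)) :=
          Real.rpow_le_rpow_of_nonpos (by positivity) hWn (by linarith)
      _ = _ := by
          rw [← Real.rpow_mul (by positivity)]
          congr 1; field_simp
  set N := size (W n) (L n) with hNdef
  set ε₀ := Real.exp (-(Real.sqrt ((W n : ℝ) ^ τ) / 2)) with hε₀
  set a := block (W n) (L n) y
  set b := block (W n) (L n) x
  have hN0 : 0 < N := by linarith
  have hs2 : 4 / (1 - s n) ≤ 4 * N := by
    rw [div_le_iff₀ (by linarith)]
    have h2 : N * N⁻¹ = 1 := mul_inv_cancel₀ hN0.ne'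
    nlinarith
  have hprim' : |primLoop (W n) (L n) (E n) (s n) a b| ≤ 4 * N * ε₀ :=
    hprim.trans (mul_le_mul hs2 he2 (Real.exp_pos _).le (by positivity))
  have hloop : ‖loop (W n) (L n) (E n) (s n) (H n ω) a b‖ ≤
      N * (N ^ 8 * ε₀ + N ^ (-(2 * D₁ + 4))) + 4 * N * ε₀ := by
    have h1 := norm_sub_norm_le (loop (W n) (L n) (E n) (s n) (H n ω) a b)
      (primLoop (W n) (L n) (E n) (s n) a b : ℂ)
    rw [Complex.norm_real, Real.norm_eq_abs] at h1
    have h2 : N ^ (1 : ℝ) * ((eta (E n) (r n) / eta (E n) (s n)) ^ 4 *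
        (Mt (W n) (L n) (E n) (s n) ^ 2)⁻¹ *
        Real.exp (-(Real.sqrt (perNorm (b - a)) / Real.sqrt (ell (L n) (s n)))) +
        (W n : ℝ) ^ (-((2 * D₁ + 4) / c))) ≤ N * (N ^ 8 * ε₀ + N ^ (-(2 * D₁ + 4))) := by
      rw [Real.rpow_one]
      refine mul_le_mul_of_nonneg_left (add_le_add ?_ hWD) hN0.le
      calc _ ≤ N ^ 4 * N ^ 4 * ε₀ := by gcongr
        _ = _ := by ring
    linarith
  have hp : ∀ k : ℝ, 0 < N ^ k := fun k => Real.rpow_pos_of_pos hN0 k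
  have hW4 : (W n : ℝ) ^ 4 ≤ N ^ 2 := by
    calc (W n : ℝ) ^ 4 = ((W n : ℝ) ^ 2) ^ 2 := by ring
      _ ≤ N ^ 2 := by gcongr
  have hε₀0 : 0 < ε₀ := Real.exp_pos _
  -- The prefactors cost at most `N² · N · N⁸`: from `W⁴`, from `≺`, and from the ratio of the `η`
  -- together with `M_s⁻²`. The exponent `2 D₁ + 12` of the exponential leaves a spare `N⁻¹`.
  have hfin : ‖G (W n) (L n) (E n) (s n) (H n ω) true x y‖ ^ 2 ≤ (N ^ (-D₁)) ^ 2 := by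
    calc _ ≤ N ^ 2 * (N * (N ^ 8 * ε₀ + N ^ (-(2 * D₁ + 4))) + 4 * N * ε₀) :=
          hGn.trans (mul_le_mul hW4 hloop (norm_nonneg _) (by positivity))
      _ ≤ N ^ 2 * (N * (N ^ 8 * N ^ (-(2 * D₁ + 12)) + N ^ (-(2 * D₁ + 4))) +
            4 * N * N ^ (-(2 * D₁ + 12))) := by gcongr
      _ = N ^ (-(2 * D₁)) * (2 * N⁻¹ + 4 * (N ^ 9)⁻¹) := by
          have e1 : N ^ (-(2 * D₁ + 12)) = N ^ (-(2 * D₁)) * (N ^ 12)⁻¹ := by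
            rw [← Real.rpow_natCast, ← Real.rpow_neg hN0.le, ← Real.rpow_add hN0]
            congr 1; push_cast; ring
          have e2 : N ^ (-(2 * D₁ + 4)) = N ^ (-(2 * D₁)) * (N ^ 4)⁻¹ := by
            rw [← Real.rpow_natCast, ← Real.rpow_neg hN0.le, ← Real.rpow_add hN0]
            congr 1; push_cast; ring
          rw [e1, e2]
          field_simp
          ring
      _ ≤ N ^ (-(2 * D₁)) * 1 := by
          refine mul_le_mul_of_nonneg_left ?_ (hp _).le
          have h9 : N ≤ N ^ 9 := le_self_pow₀ (by linarith) (by norm_num)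
          have h10 : (N ^ 9)⁻¹ ≤ N⁻¹ := inv_anti₀ hN0 h9
          have h11 : N⁻¹ ≤ 10⁻¹ := inv_anti₀ (by norm_num) hN10
          linarith
      _ = _ := by
          rw [mul_one, ← Real.rpow_natCast, ← Real.rpow_mul hN0.le]
          congr 1; push_cast; ring
  exact absurd (le_of_sq_le_sq hfin (hp _).le) (not_le.2 hG)

/-- Any polynomial bound on the entries is enough, since it is multiplied by an arbitrarily small
resolvent entry; so Chebyshev's inequality and a union bound over the `N²` entries suffice. -/
theorem eventually_measure_entry_gt_le [∀ n, IsProbabilityMeasure (P n)]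
    (hH : ∀ n, IsBandMatrix (W n) (L n) (P n) (H n))
    (hN : Tendsto (fun n => size (W n) (L n)) atTop atTop) {D : ℝ} (hD : 0 < D) :
    ∀ᶠ n in atTop, P n {ω | ∃ x y, size (W n) (L n) ^ (D + 4) < ‖H n ω x y‖} ≤
      ENNReal.ofReal (size (W n) (L n) ^ (-D)) := by
  filter_upwards [hN.eventually_ge_atTop 8] with n hn
  have hcard := card_site (W n) (L n)
  set N := size (W n) (L n)
  have hN0 : 0 < N := by linarith
  have hc : 0 < N ^ (D + 4) / 2 := by positivity
  have hsub : {ω | ∃ x y, N ^ (D + 4) < ‖H n ω x y‖} ⊆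
      ⋃ x, ⋃ y, {ω | 2 * (N ^ (D + 4) / 2) < ‖H n ω x y‖} := by
    rintro ω ⟨x, y, h⟩
    refine Set.mem_iUnion.2 ⟨x, Set.mem_iUnion.2 ⟨y, ?_⟩⟩
    rw [Set.mem_ofPred_eq, mul_div_cancel₀ _ two_ne_zero]
    exact h
  refine (measure_mono hsub).trans ((measure_iUnion_fintype_le _ _).trans
    ((Finset.sum_le_sum fun x _ => (measure_iUnion_fintype_le _ _).trans
      (Finset.sum_le_sum fun y _ => (hH n).measure_entry_tail_le hc x y)).trans ?_))
  rw [Finset.sum_const, Finset.sum_const, Finset.card_univ, nsmul_eq_mul, nsmul_eq_mul,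
    ← ENNReal.ofReal_natCast, hcard, ← ENNReal.ofReal_mul hN0.le, ← ENNReal.ofReal_mul hN0.le]
  refine ENNReal.ofReal_le_ofReal ?_
  have e1 : N ^ (D + 4) = N ^ D * N ^ 4 := by
    rw [Real.rpow_add hN0]; norm_cast
  have e2 : 1 ≤ N ^ D := Real.one_le_rpow (by linarith) hD.le
  rw [e1, Real.rpow_neg hN0.le]
  have e3 : N * (N * (2 / (N ^ D * N ^ 4 / 2) ^ 2)) = (N ^ D)⁻¹ * (8 * ((N ^ D)⁻¹ * (N ^ 6)⁻¹)) := by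
    field_simp
    ring
  rw [e3]
  refine mul_le_of_le_one_right (by positivity) ?_
  have e4 : (N ^ D)⁻¹ ≤ 1 := inv_le_one_of_one_le₀ e2
  have e5 : (N ^ 6)⁻¹ ≤ 8⁻¹ := inv_anti₀ (by norm_num)
    (hn.trans (le_self_pow₀ (by linarith) (by norm_num)))
  have e6 : (N ^ D)⁻¹ * (N ^ 6)⁻¹ ≤ 1 * 8⁻¹ := by gcongr
  linarith

/-- The fluctuations of `∑_b Z_{ab} Y_b` are controlled by `W^τ ℓ_s Λ (∑_b |Z_{ab}|²)^{1/2}`, up to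
errors that are smaller than any power of `N`. -/
theorem eventually_measure_fluctSum_gt_le [∀ n, IsProbabilityMeasure (P n)]
    (hN : Tendsto (fun n => size (W n) (L n)) atTop atTop) {c : ℝ} (hc : 0 < c)
    (hW : ∀ n, size (W n) (L n) ^ c ≤ (W n : ℝ))
    (hH : ∀ n, IsBandMatrix (W n) (L n) (P n) (H n))
    {κ : ℝ} (hκ : 0 < κ) {E : ℕ → ℝ} (hE : ∀ n, |E n| ≤ 2 - κ)
    {r s : ℕ → ℝ} (hr : ∀ n, 0 ≤ r n) (hrs : ∀ n, r n ≤ s n)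
    (hs : ∀ n, (size (W n) (L n))⁻¹ ≤ 1 - s n) (hdecay : LoopDecay W L P H E r s)
    {u : ℕ} {σ : ℕ → Fin u → Bool}
    {coef : ∀ n, Blk (L n) → (Fin u → Site (W n) (L n)) → (Fin u → Site (W n) (L n)) → ℂ}
    {C' : ℝ} (hcoef : ∀ n b x y, ‖coef n b x y‖ ≤ size (W n) (L n) ^ C') {τ : ℝ} (hτ : 0 < τ)
    (hloc : ∀ n b x y, (∃ i, (W n : ℝ) ^ τ * ell (L n) (s n) ≤
      (perNorm (block (W n) (L n) (x i) - b) : ℝ) + (perNorm (block (W n) (L n) (y i) - b) : ℝ)) →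
      coef n b x y = 0)
    {Λ : ℕ → ℝ} (hΛ : ∀ n, 0 < Λ n)
    (hY : StochDom P (fun n => size (W n) (L n)) (U := fun n => Blk (L n))
      (fun n b ω => ‖Ypoly (W n) (L n) (E n) (s n) (σ n) (coef n) (H n ω) b‖) (fun n _ _ => Λ n))
    (Z : ∀ n, Matrix (Blk (L n)) (Blk (L n)) ℂ) {ε D D₃ : ℝ} (hε : 0 < ε) (hD : 0 < D)
    (hD₃ : 0 < D₃) :
    ∀ᶠ n in atTop, P n (⋃ a, {ω | size (W n) (L n) ^ ε *
        (size (W n) (L n) ^ ε * Λ n + size (W n) (L n) ^ (-D₃)) *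
        ((W n : ℝ) ^ τ * ell (L n) (s n) * Real.sqrt (∑ b, ‖Z n a b‖ ^ 2)) +
        (∑ b, ‖Z n a b‖) * size (W n) (L n) ^ (-D₃) <
        ‖fluctSum (P n) (Z n) (fun ω' b =>
          Ypoly (W n) (L n) (E n) (s n) (σ n) (coef n) (H n ω') b) a ω‖}) ≤
      ENNReal.ofReal (size (W n) (L n) ^ (-D)) := by
  -- The bad events need probability `N^{-D'}` small even against the deterministic bound `B' ≤
  -- N^{4u + |C'|}` on `Y`. Then `D₁` must beat that bound, the entry size `N^{D' + 4}` and the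
  -- remaining factors in `e`.
  obtain ⟨D', hD'⟩ : ∃ D', D' = D + D₃ + (4 * u + |C'|) + 3 := ⟨_, rfl⟩
  have hC := abs_nonneg C'
  have hD'0 : 0 < D' := by rw [hD']; positivity
  obtain ⟨D₁, hD₁⟩ : ∃ D₁, D₁ = D₃ + D' + 4 * u + |C'| + 10 := ⟨_, rfl⟩
  have hD₁0 : 0 < D₁ := by rw [hD₁]; positivity
  filter_upwards [hdecay.eventually_measure_G_gt_le hN hc hW (fun n => (hH n).hermitian) hκ hE hr hrs
      hs hτ hD₁0 hD'0, eventually_measure_entry_gt_le hH hN hD'0, hY ε hε D' hD'0,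
    eventually_inv_eta_le hN hκ hE hs, hN.eventually_ge_atTop 403, hN.eventually_ge_atTop (u : ℝ),
    hN.eventually (eventually_exp_neg_mul_rpow_le (a := 1 / 800) (γ := 2 * ε) (by norm_num)
      (by positivity) (D + 4 + 2 * τ))]
    with n hG hent hYn hη hN403 hNu hexp
  obtain ⟨hη0, hη⟩ := hη
  have hWN := width_le_size (W := W n) (L := L n)
  have hLN := length_le_size (W := W n) (L := L n)
  have hL2N := sq_length_le_size (W := W n) (L := L n)
  have hW1 := one_le_cast_of_neZero (W n)
  have hsn := hs n
  set N := size (W n) (L n) with hNdef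
  have hN0 : 0 < N := by linarith
  have hN1 : 1 ≤ N := by linarith
  have hs1 : s n < 1 := by
    have : 0 < N⁻¹ := by positivity
    linarith
  have hℓ1 := one_le_ell (L := L n) ((hr n).trans (hrs n)) hs1
  have hX1 : 1 ≤ (W n : ℝ) ^ τ := Real.one_le_rpow hW1 hτ.le
  set R := (W n : ℝ) ^ τ * ell (L n) (s n) with hR
  have hR1 : 1 ≤ R := one_le_mul_of_one_le_of_one_le hX1 hℓ1
  have hRN : R ≤ N ^ τ * N := by
    rw [hR]
    exact mul_le_mul (Real.rpow_le_rpow (by positivity) hWN hτ.le) ((ell_le _).trans hLN)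
      (by linarith) (by positivity)
  obtain ⟨e, he⟩ : ∃ e, e = (N ^ u) ^ 2 * (N ^ C' * (u * ((N ^ 2) ^ u *
    (N ^ 2 * (N ^ 2 * N ^ (D' + 4) * N ^ (-D₁)))))) := ⟨_, rfl⟩
  obtain ⟨B', hB'⟩ : ∃ B', B' = (N ^ u) ^ 2 * (N ^ C' * (N ^ 2) ^ u) := ⟨_, rfl⟩
  have hmain := measure_fluctSum_gt_le (hH n) (E := E n) (t := s n) hs1.le (σ := σ n)
    (coef := coef n) (B := N ^ C') (g := N ^ 2) (h := N ^ (D' + 4)) (q := N ^ (-D₁)) (R := R)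
    hη0 (one_le_pow₀ hN1) hη (by positivity) (by positivity) (by positivity) hR1 (hcoef n)
    (hloc n) (A := N ^ ε * Λ n) (p₁ := N ^ (-D')) (p₂ := N ^ (-D')) (p₃ := N ^ (-D'))
    (mul_nonneg (by positivity) (hΛ n).le) (by positivity) (by positivity) (by positivity) hG hent
    (by
      refine le_trans (le_of_eq ?_) hYn
      congr 1
      ext ω
      simp)
    -- This choice turns the constant `2 ν · 10 R` into `N^ε R`; the Gaussian tail becomes
    -- `exp(-N^{2ε} / 800)`.
    (Z n) (ν := N ^ ε / 20) (by positivity) he hB'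
  have hp : ∀ k : ℝ, 0 < N ^ k := fun k => Real.rpow_pos_of_pos hN0 k
  have hNp : ∀ k : ℕ, N ^ k = N ^ (k : ℝ) := fun k => (Real.rpow_natCast N k).symm
  have hmono : ∀ {a b : ℝ}, a ≤ b → N ^ a ≤ N ^ b := fun h =>
    Real.rpow_le_rpow_of_exponent_le hN1 h
  have hinv : N ^ (-1 : ℝ) ≤ 403⁻¹ := by
    rw [Real.rpow_neg_one]
    exact inv_anti₀ (by norm_num) hN403
  have he1 : e ≤ N ^ (-D₃) * N ^ (-1 : ℝ) := by
    have h1 : e ≤ (N ^ u) ^ 2 * (N ^ |C'| * (N * ((N ^ 2) ^ u *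
        (N ^ 2 * (N ^ 2 * N ^ (D' + 4) * N ^ (-D₁)))))) := by
      rw [he]
      gcongr
      exact le_abs_self C'
    refine h1.trans (le_of_eq ?_)
    have e2 : (N ^ u) ^ 2 = N ^ (2 * u : ℝ) := by
      rw [← pow_mul, hNp]; congr 1; push_cast; ring
    have e3 : (N ^ 2) ^ u = N ^ (2 * u : ℝ) := by
      rw [← pow_mul, hNp]; congr 1; push_cast; ring
    have e4 : N ^ 2 = N ^ (2 : ℝ) := by rw [hNp]; norm_num
    rw [e2, e3, e4]
    nth_rewrite 3 [← Real.rpow_one N]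
    simp only [← Real.rpow_add hN0]
    congr 1
    rw [hD₁]; ring
  have hB1 : B' * N ^ (-D') ≤ N ^ (-D₃) * N ^ (-1 : ℝ) := by
    have h1 : B' ≤ (N ^ u) ^ 2 * (N ^ |C'| * (N ^ 2) ^ u) := by
      rw [hB']
      gcongr
      exact le_abs_self C'
    have e2 : (N ^ u) ^ 2 = N ^ (2 * u : ℝ) := by
      rw [← pow_mul, hNp]; congr 1; push_cast; ring
    have e3 : (N ^ 2) ^ u = N ^ (2 * u : ℝ) := by
      rw [← pow_mul, hNp]; congr 1; push_cast; ring
    rw [e2, e3, ← Real.rpow_add hN0, ← Real.rpow_add hN0] at h1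
    refine (mul_le_mul_of_nonneg_right h1 (hp _).le).trans ?_
    rw [← Real.rpow_add hN0, ← Real.rpow_add hN0]
    apply hmono
    rw [hD']; linarith
  have he0 : e ≤ N ^ (-D₃) := he1.trans (mul_le_of_le_one_right (hp _).le (by linarith))
  refine (measure_mono (Set.iUnion_mono fun a ω hω => ?_)).trans
    (hmain.trans (ENNReal.ofReal_le_ofReal ?_))
  · rw [Set.mem_ofPred_eq] at hω ⊢
    refine lt_of_le_of_lt (add_le_add ?_ ?_) hω
    · calc 2 * (N ^ ε / 20) * (N ^ ε * Λ n + e) * (10 * R * Real.sqrt (∑ b, ‖Z n a b‖ ^ 2))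
          = N ^ ε * (N ^ ε * Λ n + e) * (R * Real.sqrt (∑ b, ‖Z n a b‖ ^ 2)) := by ring
        _ ≤ _ := by gcongr
    · refine mul_le_mul_of_nonneg_left ?_ (Finset.sum_nonneg fun _ _ => norm_nonneg _)
      have h1 : 2 * e + 2 * B' * (N ^ (-D') + N ^ (-D') + N ^ (-D')) ≤
          N ^ (-D₃) * (8 * N ^ (-1 : ℝ)) := by linarith
      exact h1.trans (mul_le_of_le_one_right (hp _).le (by linarith))
  · have h1 : N ^ (-D') ≤ N ^ (-D) * N ^ (-1 : ℝ) := by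
      rw [← Real.rpow_add hN0]
      apply hmono
      rw [hD']
      have : (0 : ℝ) ≤ 4 * u + |C'| := by positivity
      linarith
    have h2 : Real.exp (-((N ^ ε / 20) ^ 2 / 2)) ≤ N ^ (-(D + 4 + 2 * τ)) := by
      refine le_trans (le_of_eq ?_) hexp
      congr 1
      have : N ^ (2 * ε) = (N ^ ε) ^ 2 := by
        rw [← Real.rpow_natCast, ← Real.rpow_mul hN0.le]; congr 1; push_cast; ring
      rw [this]; ring
    have h3 : (L n : ℝ) ^ 2 * (100 * R ^ 2 * (4 * Real.exp (-((N ^ ε / 20) ^ 2 / 2)))) ≤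
        N * (100 * (N ^ τ * N) ^ 2 * (4 * N ^ (-(D + 4 + 2 * τ)))) := by gcongr
    have h4 : N * (100 * (N ^ τ * N) ^ 2 * (4 * N ^ (-(D + 4 + 2 * τ)))) =
        400 * (N ^ (-D) * N ^ (-1 : ℝ)) := by
      have e1 : N ^ (-(D + 4 + 2 * τ)) = N ^ (-D) * N ^ (-1 : ℝ) * (N ^ 3)⁻¹ * ((N ^ τ) ^ 2)⁻¹ := by
        have : (N ^ τ) ^ 2 = N ^ (2 * τ) := by
          rw [← Real.rpow_natCast, ← Real.rpow_mul hN0.le]; congr 1; push_cast; ring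
        rw [this, hNp, ← Real.rpow_neg hN0.le, ← Real.rpow_neg hN0.le, ← Real.rpow_add hN0,
          ← Real.rpow_add hN0, ← Real.rpow_add hN0]
        congr 1; push_cast; ring
      rw [e1]
      have := hp τ
      field_simp
      ring
    -- The total is `3 + 400` multiples of `N^{-D-1}`: three bad events and the tails of all colour
    -- classes and rows.
    have h5 : N ^ (-D) * N ^ (-1 : ℝ) ≤ N ^ (-D) * 403⁻¹ := by gcongr
    linarith

end Family

/-! ### Square sums of the weights -/

theorem sqrt_sum_norm_sq_le_of_range {L : ℕ} [NeZero L] {z : Blk L → ℂ} {a : Blk L} {R : ℝ}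
    (hR : 1 ≤ R) (hz : ∀ b, R ≤ (perNorm (a - b) : ℝ) → z b = 0) :
    Real.sqrt (∑ b, ‖z b‖ ^ 2) ≤ 3 * R * ⨆ b, ‖z b‖ := by
  have hsup : ∀ b, ‖z b‖ ≤ ⨆ b, ‖z b‖ := le_ciSup (Set.finite_range _).bddAbove
  have h0 : 0 ≤ ⨆ b, ‖z b‖ := (norm_nonneg _).trans (hsup a)
  apply Real.sqrt_le_iff.2 ⟨by positivity, ?_⟩
  have h1 : ∑ b, ‖z b‖ ^ 2 ≤ ∑ b, if (perNorm (a - b) : ℝ) < R then (⨆ b, ‖z b‖) ^ 2 else 0 := by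
    refine Finset.sum_le_sum fun b _ => ?_
    split_ifs with h
    · have := hsup b; gcongr
    · rw [hz b (not_lt.1 h)]; simp
  rw [← Finset.sum_filter, Finset.sum_const, nsmul_eq_mul] at h1
  refine h1.trans ?_
  calc _ ≤ 9 * R ^ 2 * (⨆ b, ‖z b‖) ^ 2 := by gcongr; exact card_perNorm_sub_lt_le a hR
    _ = _ := by ring

theorem sqrt_sum_norm_sq_le_of_decay {L : ℕ} [NeZero L] {z : Blk L → ℂ} {a : Blk L} {K : ℝ}
    (hK : 0 ≤ K) (hz : ∀ b, ‖z b‖ ≤ K * (1 + (perNorm (a - b) : ℝ))⁻¹) :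
    Real.sqrt (∑ b, ‖z b‖ ^ 2) ≤ K * (2 * (1 + Real.log L)) := by
  have hlog : 0 ≤ Real.log L := Real.log_natCast_nonneg L
  apply Real.sqrt_le_iff.2 ⟨by positivity, ?_⟩
  calc ∑ b, ‖z b‖ ^ 2 ≤ ∑ b, (K * (1 + (perNorm (a - b) : ℝ))⁻¹) ^ 2 := by
        gcongr with b; exact hz b
    _ = K ^ 2 * ∑ b : Blk L, ((1 + (perNorm (a - b) : ℝ))⁻¹) ^ 2 := by
        rw [Finset.mul_sum]; exact Finset.sum_congr rfl fun _ _ => by ring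
    _ ≤ K ^ 2 * (2 * (1 + Real.log L)) ^ 2 := by
        gcongr; exact sum_inv_one_add_perNorm_sq_le a
    _ = _ := by ring

theorem sum_norm_le_card_mul {L : ℕ} [NeZero L] {z : Blk L → ℂ} {K : ℝ} (hz : ∀ b, ‖z b‖ ≤ K) :
    ∑ b, ‖z b‖ ≤ (L : ℝ) ^ 2 * K := by
  calc ∑ b, ‖z b‖ ≤ ∑ _b : Blk L, K := Finset.sum_le_sum fun b _ => hz b
    _ = _ := by
      rw [Finset.sum_const, Finset.card_univ, Fintype.card_prod, ZMod.card, nsmul_eq_mul]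
      push_cast; ring

/-! ### Absorbing the errors into the asserted bounds -/

theorem error_le_of_range {W L : ℕ} [NeZero W] [NeZero L] {s t τ ε D Λ : ℝ} (hs0 : 0 ≤ s)
    (hs1 : s < 1) (ht0 : 0 ≤ t) (ht1 : t < 1) (hτ : 0 < τ) (hε : 0 < ε) (hD : 0 < D) (hΛ : 0 < Λ)
    {z : Blk L → ℂ} {a : Blk L}
    (hz : ∀ b, (W : ℝ) ^ τ * ell L t ≤ (perNorm (a - b) : ℝ) → z b = 0)
    (h3 : 3 ≤ size W L ^ (ε / 3)) (hN2 : 2 ≤ size W L) :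
    size W L ^ (ε / 3) * (size W L ^ (ε / 3) * Λ + size W L ^ (-(D + 2 * τ + 3))) *
        ((W : ℝ) ^ τ * ell L s * Real.sqrt (∑ b, ‖z b‖ ^ 2)) +
      (∑ b, ‖z b‖) * size W L ^ (-(D + 2 * τ + 3)) ≤
    size W L ^ ε * ((W : ℝ) ^ (2 * τ) * ell L t * ell L s * (⨆ b, ‖z b‖) * Λ +
      (W : ℝ) ^ (-D) * ⨆ b, ‖z b‖) := by
  have hWN := width_le_size (W := W) (L := L)
  have hLN := length_le_size (W := W) (L := L)
  have hL2N := sq_length_le_size (W := W) (L := L)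
  have hW1 := one_le_cast_of_neZero W
  have hℓs := one_le_ell (L := L) hs0 hs1
  have hℓt := one_le_ell (L := L) ht0 ht1
  have hℓsL := (ell_le (L := L) s).trans hLN
  have hℓtL := (ell_le (L := L) t).trans hLN
  have hX1 : 1 ≤ (W : ℝ) ^ τ := Real.one_le_rpow hW1 hτ.le
  have hXN : (W : ℝ) ^ τ ≤ size W L ^ τ :=
    Real.rpow_le_rpow (by positivity) hWN hτ.le
  have hsq := sqrt_sum_norm_sq_le_of_range (z := z) (a := a)
    (one_le_mul_of_one_le_of_one_le hX1 hℓt) hz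
  have hsup : ∀ b, ‖z b‖ ≤ ⨆ b, ‖z b‖ := le_ciSup (Set.finite_range _).bddAbove
  have hsum := sum_norm_le_card_mul hsup
  have hz0 : 0 ≤ ⨆ b, ‖z b‖ := (norm_nonneg _).trans (hsup a)
  set N := size W L with hNdef
  set m := ⨆ b, ‖z b‖
  set X := (W : ℝ) ^ τ with hX
  set ℓs := ell L s
  set ℓt := ell L t
  have hN0 : 0 < N := by linarith
  have hX2 : (W : ℝ) ^ (2 * τ) = X ^ 2 := by
    rw [hX, ← Real.rpow_natCast, ← Real.rpow_mul (by positivity)]; congr 1; push_cast; ring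
  -- Two of the three factors come from the concentration bound and the third absorbs the constant
  -- `3` of the row norm. The exponent `2 τ` collects one `W^τ` from the localization radius and one
  -- from the range of `Z`.
  have hNε : N ^ ε = N ^ (ε / 3) * N ^ (ε / 3) * N ^ (ε / 3) := by
    rw [← Real.rpow_add hN0, ← Real.rpow_add hN0]; congr 1; ring
  have hN1ε : 1 ≤ N ^ (ε / 3) := by linarith
  have hWD : N ^ (-D) ≤ (W : ℝ) ^ (-D) :=
    Real.rpow_le_rpow_of_nonpos (by positivity) hWN (by linarith)
  have hND : N ^ (-(D + 2 * τ + 3)) = N ^ (-D) * ((N ^ τ) ^ 2)⁻¹ * (N ^ 3)⁻¹ := by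
    rw [← Real.rpow_natCast, ← Real.rpow_natCast, ← Real.rpow_mul hN0.le, ← Real.rpow_neg hN0.le,
      ← Real.rpow_neg hN0.le, ← Real.rpow_add hN0, ← Real.rpow_add hN0]
    congr 1; push_cast; ring
  have hNτ : 1 ≤ N ^ τ := hX1.trans hXN
  have hinv : N⁻¹ ≤ 2⁻¹ := inv_anti₀ (by norm_num) hN2
  generalize hq : N ^ (-(D + 2 * τ + 3)) = q at hND ⊢
  have hq0 : 0 ≤ q := by rw [← hq]; positivity
  have hp : 0 < N ^ (-D) := by positivity
  have t1 : N ^ (ε / 3) * q * (X * ℓs * (3 * (X * ℓt) * m)) ≤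
      N ^ ε * (2⁻¹ * ((W : ℝ) ^ (-D) * m)) := by
    calc N ^ (ε / 3) * q * (X * ℓs * (3 * (X * ℓt) * m))
        ≤ N ^ (ε / 3) * q * (N ^ τ * N * (N ^ (ε / 3) * (N ^ τ * N) * m)) := by gcongr
      _ = N ^ (ε / 3) * N ^ (ε / 3) * 1 * (N⁻¹ * (N ^ (-D) * m)) := by
          rw [hND]; field_simp
      _ ≤ N ^ (ε / 3) * N ^ (ε / 3) * N ^ (ε / 3) * (2⁻¹ * ((W : ℝ) ^ (-D) * m)) := by gcongr
      _ = _ := by rw [hNε]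
  have t2 : (L : ℝ) ^ 2 * m * q ≤ N ^ ε * (2⁻¹ * ((W : ℝ) ^ (-D) * m)) := by
    have h1 : 1 ≤ N ^ ε := Real.one_le_rpow (by linarith) hε.le
    have h2 : N * q ≤ 2⁻¹ * N ^ (-D) := by
      have e1 : N * q = N ^ (-D) * (((N ^ τ) ^ 2)⁻¹ * (N⁻¹ * N⁻¹)) := by
        rw [hND]; field_simp
      have e2 : ((N ^ τ) ^ 2)⁻¹ ≤ 1 := inv_le_one_of_one_le₀ (one_le_pow₀ hNτ)
      have e3 : ((N ^ τ) ^ 2)⁻¹ * (N⁻¹ * N⁻¹) ≤ 1 * (2⁻¹ * 1) := by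
        gcongr
        exact inv_le_one_of_one_le₀ (by linarith)
      rw [e1]
      nlinarith
    calc (L : ℝ) ^ 2 * m * q ≤ N * m * q := by gcongr
      _ = 1 * (N * q * m) := by ring
      _ ≤ N ^ ε * (2⁻¹ * N ^ (-D) * m) := by gcongr
      _ ≤ N ^ ε * (2⁻¹ * (W : ℝ) ^ (-D) * m) := by gcongr
      _ = _ := by ring
  have t3 : N ^ (ε / 3) * (N ^ (ε / 3) * Λ) * (X * ℓs * (3 * (X * ℓt) * m)) ≤
      N ^ ε * ((W : ℝ) ^ (2 * τ) * ℓt * ℓs * m * Λ) := by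
    calc _ ≤ N ^ (ε / 3) * (N ^ (ε / 3) * Λ) * (X * ℓs * (N ^ (ε / 3) * (X * ℓt) * m)) := by
          gcongr
      _ = _ := by rw [hX2, hNε]; ring
  calc _ ≤ N ^ (ε / 3) * (N ^ (ε / 3) * Λ + q) * (X * ℓs * (3 * (X * ℓt) * m)) +
        (L : ℝ) ^ 2 * m * q := by gcongr
    _ = N ^ (ε / 3) * (N ^ (ε / 3) * Λ) * (X * ℓs * (3 * (X * ℓt) * m)) +
        N ^ (ε / 3) * q * (X * ℓs * (3 * (X * ℓt) * m)) + (L : ℝ) ^ 2 * m * q := by ring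
    _ ≤ N ^ ε * ((W : ℝ) ^ (2 * τ) * ℓt * ℓs * m * Λ) +
        N ^ ε * (2⁻¹ * ((W : ℝ) ^ (-D) * m)) + N ^ ε * (2⁻¹ * ((W : ℝ) ^ (-D) * m)) := by
          gcongr
    _ = _ := by ring

theorem error_le_of_decay {W L : ℕ} [NeZero W] [NeZero L] {s τ ε D Λ : ℝ} (hs0 : 0 ≤ s)
    (hs1 : s < 1) (hτ : 0 < τ) (hε : 0 < ε) (hD : 0 < D) (hΛ : 0 < Λ)
    {z : Blk L → ℂ} {a : Blk L}
    (hz : ∀ b, ‖z b‖ ≤ size W L ^ (ε / 4) * (1 + (perNorm (a - b) : ℝ))⁻¹)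
    (hlog : 2 * (1 + Real.log (size W L)) ≤ size W L ^ (ε / 4)) (hN2 : 2 ≤ size W L) :
    size W L ^ (ε / 4) * (size W L ^ (ε / 4) * Λ + size W L ^ (-(D + τ + 2))) *
        ((W : ℝ) ^ τ * ell L s * Real.sqrt (∑ b, ‖z b‖ ^ 2)) +
      (∑ b, ‖z b‖) * size W L ^ (-(D + τ + 2)) ≤
    size W L ^ ε * ((W : ℝ) ^ (2 * τ) * ell L s * Λ + (W : ℝ) ^ (-D)) := by
  have hWN := width_le_size (W := W) (L := L)
  have hLN := length_le_size (W := W) (L := L)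
  have hL2N := sq_length_le_size (W := W) (L := L)
  have hW1 := one_le_cast_of_neZero W
  have hL1 := one_le_cast_of_neZero L
  have hℓs := one_le_ell (L := L) hs0 hs1
  have hℓsL := (ell_le (L := L) s).trans hLN
  have hX1 : 1 ≤ (W : ℝ) ^ τ := Real.one_le_rpow hW1 hτ.le
  have hXN : (W : ℝ) ^ τ ≤ size W L ^ τ :=
    Real.rpow_le_rpow (by positivity) hWN hτ.le
  have hX2 : (W : ℝ) ^ τ ≤ (W : ℝ) ^ (2 * τ) :=
    Real.rpow_le_rpow_of_exponent_le hW1 (by linarith)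
  set N := size W L with hNdef
  have hN0 : 0 < N := by linarith
  have hsq := sqrt_sum_norm_sq_le_of_decay (z := z) (a := a) (K := N ^ (ε / 4))
    (by positivity) hz
  have hsum := sum_norm_le_card_mul (z := z) (K := N ^ (ε / 4)) fun b =>
    (hz b).trans (mul_le_of_le_one_right (by positivity)
      (inv_le_one_of_one_le₀ (by simp)))
  have hsq' : Real.sqrt (∑ b, ‖z b‖ ^ 2) ≤ N ^ (ε / 4) * N ^ (ε / 4) := by
    refine hsq.trans (mul_le_mul_of_nonneg_left (le_trans ?_ hlog) (by positivity))
    have := Real.log_le_log (by linarith) hLN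
    linarith
  set X := (W : ℝ) ^ τ with hX
  set ℓs := ell L s
  -- Two factors come from the concentration bound, one from the domination of `Z`, and one from the
  -- logarithm.
  have hNε : N ^ ε = N ^ (ε / 4) * N ^ (ε / 4) * (N ^ (ε / 4) * N ^ (ε / 4)) := by
    rw [← Real.rpow_add hN0, ← Real.rpow_add hN0]; congr 1; ring
  have hN1ε : 1 ≤ N ^ (ε / 4) := Real.one_le_rpow (by linarith) (by positivity)
  have hWD : N ^ (-D) ≤ (W : ℝ) ^ (-D) :=
    Real.rpow_le_rpow_of_nonpos (by positivity) hWN (by linarith)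
  have hND : N ^ (-(D + τ + 2)) = N ^ (-D) * (N ^ τ)⁻¹ * (N ^ 2)⁻¹ := by
    rw [← Real.rpow_natCast, ← Real.rpow_neg hN0.le, ← Real.rpow_neg hN0.le,
      ← Real.rpow_add hN0, ← Real.rpow_add hN0]
    congr 1; push_cast; ring
  have hNτ : 1 ≤ N ^ τ := hX1.trans hXN
  have hinv : N⁻¹ ≤ 2⁻¹ := inv_anti₀ (by norm_num) hN2
  generalize hq : N ^ (-(D + τ + 2)) = q at hND ⊢
  have hq0 : 0 ≤ q := by rw [← hq]; positivity
  generalize hy : N ^ (ε / 4) = y at hNε hN1ε hsq' hsum ⊢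
  have hp : 0 < N ^ (-D) := by positivity
  have hNε1 : 1 ≤ N ^ ε := Real.one_le_rpow (by linarith) hε.le
  have t1 : y * q * (X * ℓs * (y * y)) ≤ N ^ ε * (2⁻¹ * (W : ℝ) ^ (-D)) := by
    calc y * q * (X * ℓs * (y * y)) ≤ y * q * (N ^ τ * N * (y * y)) := by gcongr
      _ = 1 * (y * (y * y)) * (N⁻¹ * N ^ (-D)) := by
          rw [hND]; field_simp
      _ ≤ y * (y * (y * y)) * (2⁻¹ * (W : ℝ) ^ (-D)) := by gcongr
      _ = _ := by rw [hNε]; ring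
  have t2 : (L : ℝ) ^ 2 * y * q ≤ N ^ ε * (2⁻¹ * (W : ℝ) ^ (-D)) := by
    have h1 : y ≤ N ^ ε := by
      rw [← hy]
      exact Real.rpow_le_rpow_of_exponent_le (by linarith) (by linarith)
    have h2 : N * q ≤ 2⁻¹ * N ^ (-D) := by
      have e1 : N * q = N ^ (-D) * ((N ^ τ)⁻¹ * N⁻¹) := by
        rw [hND]; field_simp
      have e2 : (N ^ τ)⁻¹ ≤ 1 := inv_le_one_of_one_le₀ hNτ
      have e3 : (N ^ τ)⁻¹ * N⁻¹ ≤ 1 * 2⁻¹ := by gcongr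
      rw [e1]
      nlinarith
    calc (L : ℝ) ^ 2 * y * q ≤ N * y * q := by gcongr
      _ = y * (N * q) := by ring
      _ ≤ N ^ ε * (2⁻¹ * N ^ (-D)) := by gcongr
      _ ≤ _ := by gcongr
  have t3 : y * (y * Λ) * (X * ℓs * (y * y)) ≤ N ^ ε * ((W : ℝ) ^ (2 * τ) * ℓs * Λ) := by
    calc _ = N ^ ε * (X * ℓs * Λ) := by rw [hNε]; ring
      _ ≤ _ := by gcongr
  calc _ ≤ y * (y * Λ + q) * (X * ℓs * (y * y)) + (L : ℝ) ^ 2 * y * q := by gcongr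
    _ = y * (y * Λ) * (X * ℓs * (y * y)) + y * q * (X * ℓs * (y * y)) +
        (L : ℝ) ^ 2 * y * q := by ring
    _ ≤ N ^ ε * ((W : ℝ) ^ (2 * τ) * ℓs * Λ) + N ^ ε * (2⁻¹ * (W : ℝ) ^ (-D)) +
        N ^ ε * (2⁻¹ * (W : ℝ) ^ (-D)) := by gcongr
    _ = _ := by ring

end BandMatrix

end

theorem lemma7p4 :
    ∃ C : ℝ, 0 < C ∧
    ∀ -- the sizes of the models, with `N = W² L² → ∞` and `W ≥ N^𝔠`
      (W L : ℕ → ℕ) [∀ n, NeZero (W n)] [∀ n, NeZero (L n)]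
      (_hN : Tendsto (fun n => BandMatrix.size (W n) (L n)) atTop atTop)
      (𝔠 : ℝ) (_h𝔠 : 0 < 𝔠) (_hW : ∀ n, BandMatrix.size (W n) (L n) ^ 𝔠 ≤ (W n : ℝ))
      -- the random band matrices
      (Ω : ℕ → Type*) [∀ n, MeasurableSpace (Ω n)]
      (P : ∀ n, Measure (Ω n)) [∀ n, IsProbabilityMeasure (P n)]
      (H : ∀ n, Ω n → Matrix (BandMatrix.Site (W n) (L n)) (BandMatrix.Site (W n) (L n)) ℂ)
      (_hH : ∀ n, BandMatrix.IsBandMatrix (W n) (L n) (P n) (H n))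
      -- energies in the bulk, and times
      (κ : ℝ) (_hκ : 0 < κ) (E : ℕ → ℝ) (_hE : ∀ n, |E n| ≤ 2 - κ)
      (δ : ℝ) (_hδ : 0 < δ) (r s : ℕ → ℝ) (_hr : ∀ n, 0 ≤ r n) (_hrs : ∀ n, r n ≤ s n)
      (_hs : ∀ n, s n ≤ 1 - BandMatrix.size (W n) (L n) ^ (-1 + δ))
      (_hlaw : BandMatrix.LocalLaw W L P H E s)
      (_hdecay : BandMatrix.LoopDecay W L P H E r s)
      -- the polynomials `Y_{s,b}` in the resolvent entries
      (u : ℕ) (σ : ℕ → Fin u → Bool)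
      (coef : ∀ n, BandMatrix.Blk (L n) → (Fin u → BandMatrix.Site (W n) (L n)) →
        (Fin u → BandMatrix.Site (W n) (L n)) → ℂ)
      (C' : ℝ) (_hcoef : ∀ n b x y, ‖coef n b x y‖ ≤ BandMatrix.size (W n) (L n) ^ C')
      (τ : ℝ) (_hτ : 0 < τ)
      (_hloc : ∀ n b x y,
        (∃ i, (W n : ℝ) ^ τ * BandMatrix.ell (L n) (s n) ≤
          (BandMatrix.perNorm (BandMatrix.block (W n) (L n) (x i) - b) : ℝ)
            + (BandMatrix.perNorm (BandMatrix.block (W n) (L n) (y i) - b) : ℝ)) →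
        coef n b x y = 0)
      (Λ : ℕ → ℝ) (_hΛ : ∀ n, 0 < Λ n)
      (_hY : BandMatrix.StochDom P (fun n => BandMatrix.size (W n) (L n))
        (U := fun n => BandMatrix.Blk (L n))
        (fun n b ω => ‖BandMatrix.Ypoly (W n) (L n) (E n) (s n) (σ n) (coef n) (H n ω) b‖)
        (fun n _ _ => Λ n))
      -- the deterministic weights `Z_{ab}`
      (Z : ∀ n, Matrix (BandMatrix.Blk (L n)) (BandMatrix.Blk (L n)) ℂ),
    -- Case 1: `Z` has range `W^τ ℓ_t`
    (∀ t : ℕ → ℝ, (∀ n, 0 ≤ t n) → (∀ n, t n < 1) →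
      (∀ n a b, (W n : ℝ) ^ τ * BandMatrix.ell (L n) (t n) ≤
        (BandMatrix.perNorm (a - b) : ℝ) → Z n a b = 0) →
      ∀ D : ℝ, 0 < D →
      BandMatrix.StochDom P (fun n => BandMatrix.size (W n) (L n))
        (U := fun n => BandMatrix.Blk (L n))
        (fun n a ω => ‖BandMatrix.fluctSum (P n) (Z n) (fun ω' b =>
          BandMatrix.Ypoly (W n) (L n) (E n) (s n) (σ n) (coef n) (H n ω') b) a ω‖)
        (fun n a _ => (W n : ℝ) ^ (C * τ) * BandMatrix.ell (L n) (t n)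
            * BandMatrix.ell (L n) (s n) * (⨆ b, ‖Z n a b‖) * Λ n
          + (W n : ℝ) ^ (-D) * (⨆ b, ‖Z n a b‖))) ∧
    -- Case 2: `Z_{ab} ≺ (1 + |a - b|_L)⁻¹`
    (BandMatrix.DetDom (fun n => BandMatrix.size (W n) (L n))
        (U := fun n => BandMatrix.Blk (L n) × BandMatrix.Blk (L n))
        (fun n p => ‖Z n p.1 p.2‖)
        (fun _ p => (1 + (BandMatrix.perNorm (p.1 - p.2) : ℝ))⁻¹) →
      ∀ D : ℝ, 0 < D →
      BandMatrix.StochDom P (fun n => BandMatrix.size (W n) (L n))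
        (U := fun n => BandMatrix.Blk (L n))
        (fun n a ω => ‖BandMatrix.fluctSum (P n) (Z n) (fun ω' b =>
          BandMatrix.Ypoly (W n) (L n) (E n) (s n) (σ n) (coef n) (H n ω') b) a ω‖)
        (fun n _ _ => (W n : ℝ) ^ (C * τ) * BandMatrix.ell (L n) (s n) * Λ n
          + (W n : ℝ) ^ (-D))) := by

  -- Case 1 produces `W^{2τ}`; Case 2 produces only `W^τ`, which is enlarged to the same power.
  refine ⟨2, by norm_num, ?_⟩
  intro W L _ _ hN c hc hW Ω _ P _ H hH κ hκ E hE δ hδ r s hr hrs hs hlaw hdecay u σ coef C' hcoef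
    τ hτ hloc Λ hΛ hY Z
  have hs' : ∀ n, (BandMatrix.size (W n) (L n))⁻¹ ≤ 1 - s n := fun n => by
    have h1 : BandMatrix.size (W n) (L n) ^ (-1 : ℝ) ≤ BandMatrix.size (W n) (L n) ^ (-1 + δ) :=
      Real.rpow_le_rpow_of_exponent_le BandMatrix.one_le_size (by linarith)
    rw [Real.rpow_neg_one] at h1
    linarith [hs n]
  have hs1 : ∀ n, s n < 1 := fun n => by
    have h1 := hs' n
    have h2 : 0 < (BandMatrix.size (W n) (L n))⁻¹ :=
      inv_pos.2 (one_pos.trans_le BandMatrix.one_le_size)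
    linarith
  have core := fun {ε D D₃ : ℝ} => BandMatrix.eventually_measure_fluctSum_gt_le
    (ε := ε) (D := D) (D₃ := D₃) hN hc hW hH hκ hE hr hrs hs' hdecay hcoef hτ hloc hΛ hY Z
  constructor
  · intro t ht0 ht1 hZ D hD ε hε D' hD'
    filter_upwards [core (ε := ε / 3) (D := D') (D₃ := D + 2 * τ + 3) (by positivity) hD'
      (by positivity), hN.eventually (BandMatrix.eventually_le_rpow 3 (γ := ε / 3) (by positivity)),
      hN.eventually_ge_atTop 2] with n hn h3 hN2
    refine (measure_mono (Set.iUnion_mono fun a ω hω => ?_)).trans hn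
    rw [Set.mem_ofPred_eq] at hω ⊢
    exact (BandMatrix.error_le_of_range ((hr n).trans (hrs n)) (hs1 n) (ht0 n) (ht1 n) hτ hε hD
      (hΛ n) (hZ n a) h3 hN2).trans_lt hω
  · intro hZ D hD ε hε D' hD'
    filter_upwards [core (ε := ε / 4) (D := D') (D₃ := D + τ + 2) (by positivity) hD'
      (by positivity), hZ (ε / 4) (by positivity),
      hN.eventually (BandMatrix.eventually_log_le_rpow (γ := ε / 4) (by positivity)),
      hN.eventually_ge_atTop 2] with n hn hZn hlog hN2
    refine (measure_mono (Set.iUnion_mono fun a ω hω => ?_)).trans hn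
    rw [Set.mem_ofPred_eq] at hω ⊢
    exact (BandMatrix.error_le_of_decay ((hr n).trans (hrs n)) (hs1 n) hτ hε hD (hΛ n)
      (fun b => hZn (a, b)) hlog hN2).trans_lt hω
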